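/- Let $d\ge 2$ and let $\mathcal T$ be a multiple stellar subdivision of a $(d-1)$-simplex $\sigma\subset\mathbb R^{d-1}$, that is, $\mathcal T$ arises from the triangulation consisting of $\sigma$ and its faces by a finite sequence of one or more single stellar subdivisions. Here a single stellar subdivision of a triangulation at one of its $(d-1)$-simplices $\tau$ by a point $p$ in the interior of $\tau$ replaces $\tau$ by the simplices spanned by $p$ and a proper (possibly empty) face of $\tau$; in particular, it generates $d$ new $(d-1)$-simplices, spanned by $p$ and the $(d-2)$-faces of $\tau$. A triangulation of the convex hull of a finite set $V\subset\mathbb R^{d-1}$ that affinely spans $\mathbb R^{d-1}$, with vertex set $V$, is a Delaunay triangulation if for every $(d-1)$-simplex of it there is a sphere through the vertices of this simplex such that all other points of $V$ lie strictly outside the sphere. Then the following are equivalent: (1) $\mathcal T$ can be realized as a Delaunay triangulation, that is, there is a Delaunay triangulation in $\mathbb R^{d-1}$ that is combinatorially equivalent to $\mathcal T$ (isomorphic to it as a simplicial complex); (2) for every single stellar subdivision in the sequence, at most two of the $d$ $(d-1)$-simplices that it generates are further subdivided, that is, at most two of them are simplices at which a later single stellar subdivision of the sequence is performed. -/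

import Mathlib

open Geometry

/-- `K` is the triangulation with exactly one full-dimensional simplex `σ`: its faces are the
nonempty subsets of the vertex set `σ`. -/
def IsSingleSimplex {n : ℕ} (σ : Finset (EuclideanSpace ℝ (Fin n)))
    (K : SimplicialComplex ℝ (EuclideanSpace ℝ (Fin n))) : Prop :=
  σ.card = n + 1 ∧ K.faces = {τ | τ.Nonempty ∧ τ ⊆ σ}

open Classical in
/-- `K'` is the single stellar subdivision of `K` at the full-dimensional simplex `σ` by the
point `p` in its interior: `σ` is replaced by the simplices spanned by `p` and a proper face
of `σ` (the empty face included, which gives the new vertex `p` itself). -/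
def IsStellarSubdivision {n : ℕ} (K : SimplicialComplex ℝ (EuclideanSpace ℝ (Fin n)))
    (σ : Finset (EuclideanSpace ℝ (Fin n))) (p : EuclideanSpace ℝ (Fin n))
    (K' : SimplicialComplex ℝ (EuclideanSpace ℝ (Fin n))) : Prop :=
  σ ∈ K.faces ∧ σ.card = n + 1 ∧
  p ∈ interior (convexHull ℝ (σ : Set (EuclideanSpace ℝ (Fin n)))) ∧
  K'.faces = (K.faces \ {σ}) ∪ {ρ | ∃ τ, τ ⊂ σ ∧ ρ = insert p τ}

/-- `StellarHistory σ h T`: the triangulation `T` arises from the simplex `σ` by the single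
stellar subdivisions recorded in the list `h`, the most recent one first. An entry `(τ, p)`
stands for the single stellar subdivision at the simplex `τ` by the point `p`. -/
inductive StellarHistory {n : ℕ} (σ : Finset (EuclideanSpace ℝ (Fin n))) :
    List (Finset (EuclideanSpace ℝ (Fin n)) × EuclideanSpace ℝ (Fin n)) →
    SimplicialComplex ℝ (EuclideanSpace ℝ (Fin n)) → Prop
  | start {K : SimplicialComplex ℝ (EuclideanSpace ℝ (Fin n))} (hK : IsSingleSimplex σ K) :
      StellarHistory σ [] K
  | step {h : List (Finset (EuclideanSpace ℝ (Fin n)) × EuclideanSpace ℝ (Fin n))}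
      {K K' : SimplicialComplex ℝ (EuclideanSpace ℝ (Fin n))}
      {τ : Finset (EuclideanSpace ℝ (Fin n))} {p : EuclideanSpace ℝ (Fin n)}
      (hK : StellarHistory σ h K) (hs : IsStellarSubdivision K τ p K') :
      StellarHistory σ ((τ, p) :: h) K'

/-- `T` is a multiple stellar subdivision of the simplex `σ`, obtained by the single stellar
subdivisions in the list `h`, of which there is at least one. -/
def IsMultipleStellarSubdivision {n : ℕ} (σ : Finset (EuclideanSpace ℝ (Fin n)))
    (h : List (Finset (EuclideanSpace ℝ (Fin n)) × EuclideanSpace ℝ (Fin n)))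
    (T : SimplicialComplex ℝ (EuclideanSpace ℝ (Fin n))) : Prop :=
  h ≠ [] ∧ StellarHistory σ h T

open Classical in
/-- The full-dimensional simplices generated by the single stellar subdivision at `s.1`
by the point `s.2`. -/
def generatedSimplices {n : ℕ}
    (s : Finset (EuclideanSpace ℝ (Fin n)) × EuclideanSpace ℝ (Fin n)) :
    Set (Finset (EuclideanSpace ℝ (Fin n))) :=
  {F | ∃ v ∈ s.1, F = insert s.2 (s.1.erase v)}

/-- The simplices generated by the single stellar subdivision `s` that are further subdivided,
that is, at which some single stellar subdivision in `h` is performed. (A simplex generated by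
`s` has the new vertex `s.2`, so such a subdivision necessarily comes after `s`.) -/
def furtherSubdivided {n : ℕ}
    (h : List (Finset (EuclideanSpace ℝ (Fin n)) × EuclideanSpace ℝ (Fin n)))
    (s : Finset (EuclideanSpace ℝ (Fin n)) × EuclideanSpace ℝ (Fin n)) :
    Set (Finset (EuclideanSpace ℝ (Fin n))) :=
  {F | F ∈ generatedSimplices s ∧ ∃ t ∈ h, t.1 = F}

/-- A face `F` of `K` is Delaunay if it has a supporting sphere: a sphere that passes through
the vertices of `F` such that all other vertices of `K` lie outside it. -/
def IsDelaunayFace {n : ℕ} (K : SimplicialComplex ℝ (EuclideanSpace ℝ (Fin n)))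
    (F : Finset (EuclideanSpace ℝ (Fin n))) : Prop :=
  ∃ S : EuclideanGeometry.Sphere (EuclideanSpace ℝ (Fin n)),
    (∀ v ∈ F, dist v S.center = S.radius) ∧
    ∀ w ∈ K.vertices, w ∉ F → S.radius < dist w S.center

/-- `K` is the Delaunay triangulation of the finite, affinely spanning point set `V`: it is a
triangulation of `conv V` with vertex set `V` all of whose full-dimensional faces satisfy the
empty circumsphere condition. -/
def IsDelaunayTriangulation {n : ℕ} (V : Finset (EuclideanSpace ℝ (Fin n)))
    (K : SimplicialComplex ℝ (EuclideanSpace ℝ (Fin n))) : Prop :=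
  affineSpan ℝ (V : Set (EuclideanSpace ℝ (Fin n))) = ⊤ ∧
  K.vertices = (V : Set (EuclideanSpace ℝ (Fin n))) ∧
  K.space = convexHull ℝ (V : Set (EuclideanSpace ℝ (Fin n))) ∧
  ∀ F ∈ K.faces, F.card = n + 1 → IsDelaunayFace K F

open Classical in
/-- Combinatorial equivalence of simplicial complexes: a map that is injective on the vertices
of `K` carries the faces of `K` exactly to the faces of `L`. -/
def CombinatoriallyEquivalent {n : ℕ} (K L : SimplicialComplex ℝ (EuclideanSpace ℝ (Fin n))) :
    Prop :=
  ∃ f : EuclideanSpace ℝ (Fin n) → EuclideanSpace ℝ (Fin n),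
    Set.InjOn f K.vertices ∧ L.faces = (fun s : Finset _ => s.image f) '' K.faces

/-- `T` can be realized as a Delaunay triangulation: some Delaunay triangulation in the same
dimension is combinatorially equivalent to `T`. -/
def RealizableAsDelaunay {n : ℕ} (T : SimplicialComplex ℝ (EuclideanSpace ℝ (Fin n))) : Prop :=
  ∃ (V : Finset (EuclideanSpace ℝ (Fin n)))
    (D : SimplicialComplex ℝ (EuclideanSpace ℝ (Fin n))),
    IsDelaunayTriangulation V D ∧ CombinatoriallyEquivalent T D

/-! The power function of a sphere is `‖y‖ ^ 2` plus an affine function, zero on the sphere and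
positive outside. Two of them differ by an affine function, which barycentric coordinates evaluate.
Realizability becomes a statement about labelled points: `IsDel` for full-dimensional simplices with
empty circumspheres, `IsCov` for covering the convex hull. Empty spheres alone already make the
simplices intersect along common faces.

Necessity. Undoing a stellar subdivision preserves empty circumspheres (`IsDel.of_stack`), so the
same points realize every intermediate stage. Suppose three of the simplices around `p` that replace
`τ` are subdivided. Centred at `p`, lift a point `z` to the vector `(1, ‖z‖ ^ 2, z)`, which is null
for a Lorentz form. The lifts of `p` and of the vertices of `τ` span an ideal hyperbolic simplex.
The point at infinity is stacked on its facet opposite `p`, and the three subdividing points on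
three further facets. Empty spheres yield inequalities between coordinates that express convexity of
this stacking. Discarding the coordinates of all but four vertices can be compensated so that
vectors stay null and the inequalities survive (`exists_null_sub`). What remains is an ideal
tetrahedron stacked convexly on all four facets, which `not_four_stacked` excludes by adding three
inequalities between Lorentz products.

Sufficiency. Work one generation ahead of the history: when `p` is reached, its star still consists
of the simplices of one stellar subdivision, and all of them that are ever subdivided (at most two,
opposite `a` and `b`) are treated together. The new points are put very close to `p`. Inversion at
`p` turns spheres through `p` into hyperplanes, so the difference `u` of the images of `a` and `b`
is tangent at `p` to every circumsphere of the star except those of these two simplices. Moreover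
`u` points into the simplex opposite `a` and `-u` into the one opposite `b`. Points on a tangent
line are outside the sphere, and a sphere through `p` and `p + ε u` leaves `p - δ u` outside; the
conditions away from `p` are open (`IsDel.stack_near`, `IsDel.exists_stack_two`). -/

namespace StellarDelaunay

/-! ### Barycentric coordinates of labelled simplices -/

section Bary

variable {α E : Type*} [AddCommGroup E] [Module ℝ E]

lemma affineMap_sum_smul {ι : Type*} (A : E →ᵃ[ℝ] ℝ) (s : Finset ι) (w : ι → ℝ) (y : ι → E)
    (hw : ∑ i ∈ s, w i = 1) : A (∑ i ∈ s, w i • y i) = ∑ i ∈ s, w i * A (y i) := by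
  have h : ∀ z, A z = A.linear z + A 0 := fun z => congrFun A.decomp z
  have h2 : ∀ i, w i * A (y i) = w i * A.linear (y i) + w i * A 0 := fun i => by
    rw [h (y i), mul_add]
  simp only [h2, Finset.sum_add_distrib, ← Finset.sum_mul, hw, one_mul]
  rw [h, map_sum]
  simp only [map_smul, smul_eq_mul]

/-- `l` is a system of barycentric coordinates for the full-dimensional simplex with vertices
`f v`, `v ∈ F`. -/
structure IsBary (F : Finset α) (f : α → E) (l : α → E →ᵃ[ℝ] ℝ) : Prop where
  self : ∀ v ∈ F, l v (f v) = 1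
  other : ∀ v ∈ F, ∀ w ∈ F, v ≠ w → l v (f w) = 0
  sum_eq : ∀ y, ∑ v ∈ F, l v y = 1
  sum_smul : ∀ y, ∑ v ∈ F, l v y • f v = y

namespace IsBary

variable {F A : Finset α} {f g : α → E} {l l' : α → E →ᵃ[ℝ] ℝ} {q x : α}

lemma congr (h : IsBary F f l) (hfg : ∀ v ∈ F, f v = g v) : IsBary F g l where
  self v hv := by rw [← hfg v hv, h.self v hv]
  other v hv w hw hvw := by rw [← hfg w hw, h.other v hv w hw hvw]
  sum_eq := h.sum_eq
  sum_smul y := by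
    refine Eq.trans (Finset.sum_congr rfl fun v hv => ?_) (h.sum_smul y)
    rw [hfg v hv]

lemma apply_eq (h : IsBary F f l) (B : E →ᵃ[ℝ] ℝ) (y : E) :
    B y = ∑ v ∈ F, l v y * B (f v) := by
  conv_lhs => rw [← h.sum_smul y]
  exact affineMap_sum_smul B F _ _ (h.sum_eq y)

lemma injOn (h : IsBary F f l) {v w : α} (hv : v ∈ F) (hw : w ∈ F) (hvw : f v = f w) : v = w := by
  by_contra hne
  have h1 := h.self v hv
  rw [hvw, h.other v hv w hw hne] at h1
  exact zero_ne_one h1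

variable [DecidableEq α]

/-- Replace the vertex `q` of a simplex by a point off the opposite facet. -/
lemma exchange (h : IsBary (insert q A) f l) (hq : q ∉ A) (hx : x ∉ A) (hne : l q (f x) ≠ 0) :
    IsBary (insert x A) f fun v => if v = x then (l q (f x))⁻¹ • l q
      else l v - (l v (f x) / l q (f x)) • l q := by
  have hqm : q ∈ insert q A := Finset.mem_insert_self _ _
  have hA : ∀ v ∈ A, v ∈ insert q A := fun v hv => Finset.mem_insert_of_mem hv
  have hqn : ∀ v ∈ A, q ≠ v := fun v hv e => hq (e ▸ hv)
  have hxn : ∀ v ∈ A, v ≠ x := fun v hv e => hx (e ▸ hv)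
  have hs : ∀ y, ∑ v ∈ A, l v y = 1 - l q y := fun y => by
    rw [← h.sum_eq y, Finset.sum_insert hq]; ring
  have hss : ∀ y, ∑ v ∈ A, l v y • f v = y - l q y • f q := fun y => by
    have := h.sum_smul y
    rw [Finset.sum_insert hq] at this
    rw [eq_sub_iff_add_eq, add_comm]
    exact this
  refine ⟨?_, ?_, ?_, ?_⟩
  · intro v hv
    rcases Finset.mem_insert.1 hv with rfl | hv
    · simp [hne]
    · simp [hxn v hv, h.self v (hA v hv), h.other q hqm v (hA v hv) (hqn v hv)]
  · intro v hv w hw hvw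
    rcases Finset.mem_insert.1 hv with rfl | hv <;> rcases Finset.mem_insert.1 hw with rfl | hw
    · exact absurd rfl hvw
    · simp [h.other q hqm w (hA w hw) (hqn w hw)]
    · simp [hvw, hne]
    · simp [hxn v hv, h.other v (hA v hv) w (hA w hw) hvw, h.other q hqm w (hA w hw) (hqn w hw)]
  · intro y
    rw [Finset.sum_insert hx, Finset.sum_congr rfl fun v hv => by rw [if_neg (hxn v hv)]]
    simp only [if_true, AffineMap.coe_smul, AffineMap.coe_sub, Pi.smul_apply, Pi.sub_apply,
      smul_eq_mul, Finset.sum_sub_distrib, ← Finset.sum_mul, ← Finset.sum_div, hs]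
    field_simp
    ring
  · intro y
    rw [Finset.sum_insert hx, Finset.sum_congr rfl fun v hv => by rw [if_neg (hxn v hv)]]
    have e : ∀ v, (l v - (l v (f x) / l q (f x)) • l q) y • f v
        = l v y • f v - (l q y / l q (f x)) • (l v (f x) • f v) := fun v => by
      simp only [AffineMap.coe_smul, AffineMap.coe_sub, Pi.smul_apply, Pi.sub_apply, smul_eq_mul,
        smul_smul, sub_smul]
      congr 2
      ring
    simp only [e, Finset.sum_sub_distrib, ← Finset.smul_sum, hss, if_true, AffineMap.coe_smul,
      Pi.smul_apply, smul_eq_mul]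
    rw [smul_sub, smul_smul, div_mul_cancel₀ _ hne, inv_mul_eq_div]
    abel

/-- A simplex is covered by the simplices spanned by an interior point and its facets. -/
lemma exists_cover (h : IsBary F f l) (hF : F.Nonempty) (hx : x ∉ F)
    (hpos : ∀ v ∈ F, 0 < l v (f x)) {y : E} (hy : ∀ v ∈ F, 0 ≤ l v y) :
    ∃ v ∈ F, ∃ w : α → ℝ, (∀ k ∈ insert x (F.erase v), 0 ≤ w k) ∧
      ∑ k ∈ insert x (F.erase v), w k = 1 ∧ ∑ k ∈ insert x (F.erase v), w k • f k = y := by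
  -- The ray from `f x` through `y` leaves the simplex through the facet where the ratio of
  -- coordinates is smallest; this minimal ratio is the weight of the new point.
  obtain ⟨v, hv, hmin⟩ := Finset.exists_min_image F (fun v => l v y / l v (f x)) hF
  set t := l v y / l v (f x) with ht
  have hvx : t * l v (f x) = l v y := div_mul_cancel₀ _ (hpos v hv).ne'
  have hxe : x ∉ F.erase v := fun hh => hx (Finset.mem_of_mem_erase hh)
  have hne : ∀ k ∈ F.erase v, k ≠ x := fun k hk e => hxe (e ▸ hk)
  refine ⟨v, hv, fun k => if k = x then t else l k y - t * l k (f x), ?_, ?_, ?_⟩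
  · intro k hk
    rcases Finset.mem_insert.1 hk with rfl | hk
    · simp only [if_true]
      exact div_nonneg (hy v hv) (hpos v hv).le
    · have hkF := Finset.mem_of_mem_erase hk
      simp only [hne k hk, if_false, sub_nonneg]
      exact (le_div_iff₀ (hpos k hkF)).1 (hmin k hkF)
  · rw [Finset.sum_insert hxe, Finset.sum_congr rfl fun k hk => by rw [if_neg (hne k hk)]]
    simp only [if_true, Finset.sum_sub_distrib, ← Finset.mul_sum]
    have h1 := h.sum_eq y
    have h2 := h.sum_eq (f x)
    rw [← Finset.add_sum_erase F _ hv] at h1 h2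
    have e1 : ∑ k ∈ F.erase v, l k y = 1 - l v y := by linarith
    have e2 : ∑ k ∈ F.erase v, l k (f x) = 1 - l v (f x) := by linarith
    rw [e1, e2]
    linarith
  · have e : ∀ k ∈ F.erase v, (if k = x then t else l k y - t * l k (f x)) • f k
        = l k y • f k - t • (l k (f x) • f k) := fun k hk => by
      rw [if_neg (hne k hk), sub_smul, mul_smul]
    rw [Finset.sum_insert hxe, Finset.sum_congr rfl e]
    simp only [if_true, Finset.sum_sub_distrib, ← Finset.smul_sum]
    have h1 := h.sum_smul y
    have h2 := h.sum_smul (f x)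
    rw [← Finset.add_sum_erase F _ hv] at h1 h2
    have e1 : ∑ k ∈ F.erase v, l k y • f k = y - l v y • f v := by
      rw [eq_sub_iff_add_eq, add_comm]; exact h1
    have e2 : ∑ k ∈ F.erase v, l k (f x) • f k = f x - l v (f x) • f v := by
      rw [eq_sub_iff_add_eq, add_comm]; exact h2
    rw [e1, e2, smul_sub, smul_smul, hvx]
    abel

end IsBary

end Bary

/-! ### Power functions -/

section Power

variable {E : Type*} [NormedAddCommGroup E] [InnerProductSpace ℝ E]

/-- The power function `y ↦ ‖y‖ ^ 2 + A y` of a sphere. -/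
def pw (A : E →ᵃ[ℝ] ℝ) (y : E) : ℝ := ‖y‖ ^ 2 + A y

/-- The affine part commutes with the combination, and the squared norm contributes the variance of
the points. The sign of the variance term is what puts convex combinations of points of a sphere
inside it. -/
lemma pw_sum_smul {ι : Type*} (A : E →ᵃ[ℝ] ℝ) (s : Finset ι) (w : ι → ℝ) (y : ι → E)
    (hw : ∑ i ∈ s, w i = 1) :
    pw A (∑ i ∈ s, w i • y i) = ∑ i ∈ s, w i * pw A (y i)
      - ∑ i ∈ s, w i * ‖y i - ∑ j ∈ s, w j • y j‖ ^ 2 := by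
  set x := ∑ j ∈ s, w j • y j with hx
  have h1 : ∑ i ∈ s, w i * ‖y i - x‖ ^ 2 = ∑ i ∈ s, w i * ‖y i‖ ^ 2 - ‖x‖ ^ 2 := by
    have e : ∀ i, w i * ‖y i - x‖ ^ 2
        = w i * ‖y i‖ ^ 2 - 2 * inner ℝ (w i • y i) x + w i * ‖x‖ ^ 2 := fun i => by
      rw [norm_sub_sq_real, inner_smul_left]
      simp only [conj_trivial]
      ring
    simp only [e, Finset.sum_add_distrib, Finset.sum_sub_distrib, ← Finset.mul_sum,
      ← Finset.sum_mul, hw, ← sum_inner, ← hx, real_inner_self_eq_norm_sq]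
    ring
  have h2 := affineMap_sum_smul A s w y hw
  rw [← hx] at h2
  simp only [pw, mul_add, Finset.sum_add_distrib]
  rw [h1, h2]
  ring

lemma pw_sum_smul_le {ι : Type*} (A : E →ᵃ[ℝ] ℝ) (s : Finset ι) (w : ι → ℝ) (y : ι → E)
    (hw : ∑ i ∈ s, w i = 1) (h0 : ∀ i ∈ s, 0 ≤ w i) :
    pw A (∑ i ∈ s, w i • y i) ≤ ∑ i ∈ s, w i * pw A (y i) := by
  rw [pw_sum_smul A s w y hw]
  exact sub_le_self _ (Finset.sum_nonneg fun i hi => mul_nonneg (h0 i hi) (sq_nonneg _))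

lemma pw_sub_pw (A B : E →ᵃ[ℝ] ℝ) (y : E) : pw A y - pw B y = (A - B) y := by
  simp [pw]

lemma pw_add_smul (A B : E →ᵃ[ℝ] ℝ) (t : ℝ) (y : E) : pw (A + t • B) y = pw A y + t * B y := by
  simp [pw, add_assoc]

lemma pw_combo (A B : E →ᵃ[ℝ] ℝ) (t : ℝ) (y : E) :
    pw (A + t • (B - A)) y = (1 - t) * pw A y + t * pw B y := by
  simp only [pw, AffineMap.coe_add, AffineMap.coe_smul, AffineMap.coe_sub, Pi.add_apply,
    Pi.smul_apply, Pi.sub_apply, smul_eq_mul]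
  ring

lemma affineMap_add_smul (A : E →ᵃ[ℝ] ℝ) (p u : E) (t : ℝ) :
    A (p + t • u) = A p + t * A.linear u := by
  have := A.map_vadd p (t • u)
  rw [vadd_eq_add, vadd_eq_add, add_comm (t • u) p] at this
  rw [this, map_smul, smul_eq_mul, add_comm]

/-- The restriction of a power function to a line. -/
lemma pw_add_smul_vec (A : E →ᵃ[ℝ] ℝ) (p u : E) (t : ℝ) :
    pw A (p + t • u) = pw A p + t * (2 * inner ℝ p u + A.linear u) + t ^ 2 * ‖u‖ ^ 2 := by
  simp only [pw]
  rw [affineMap_add_smul, norm_add_sq_real, inner_smul_right, norm_smul, mul_pow, Real.norm_eq_abs, sq_abs]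
  ring

end Power

/-! ### Abstract stellar subdivisions -/

lemma exists_ne_mem {α : Type*} {F : Finset α} (h : 2 ≤ F.card) (v : α) : ∃ w ∈ F, w ≠ v :=
  F.exists_mem_ne (by omega) v

section Stack

variable {α : Type*} [DecidableEq α]

/-- The vertices of a family of simplices. -/
def verts (S : Finset (Finset α)) : Finset α := S.biUnion id

/-- Replace the simplex `F` by the simplices spanned by `q` and the facets of `F`. -/
def stack (S : Finset (Finset α)) (F : Finset α) (q : α) : Finset (Finset α) :=
  S.erase F ∪ F.image fun v => insert q (F.erase v)

variable {S : Finset (Finset α)} {F G : Finset α} {p q v w : α}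

lemma mem_verts : v ∈ verts S ↔ ∃ F ∈ S, v ∈ F := by simp [verts]

lemma mem_stack : G ∈ stack S F q ↔ (G ≠ F ∧ G ∈ S) ∨ ∃ v ∈ F, insert q (F.erase v) = G := by
  simp [stack]

lemma child_mem_stack (hv : v ∈ F) : insert q (F.erase v) ∈ stack S F q :=
  mem_stack.2 (Or.inr ⟨v, hv, rfl⟩)

lemma notMem_of_notMem_verts (hq : q ∉ verts S) (hF : F ∈ S) : q ∉ F :=
  fun h => hq (mem_verts.2 ⟨F, hF, h⟩)

lemma verts_stack (hF : F ∈ S) (hc : 2 ≤ F.card) : verts (stack S F q) = insert q (verts S) := by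
  ext v
  simp only [mem_verts, Finset.mem_insert, mem_stack]
  constructor
  · rintro ⟨G, ⟨-, hG⟩ | ⟨w, hw, rfl⟩, hv⟩
    · exact Or.inr ⟨G, hG, hv⟩
    · rcases Finset.mem_insert.1 hv with rfl | hv
      · exact Or.inl rfl
      · exact Or.inr ⟨F, hF, Finset.mem_of_mem_erase hv⟩
  · rintro (rfl | ⟨G, hG, hv⟩)
    · obtain ⟨w, hw, -⟩ := exists_ne_mem hc v
      exact ⟨_, Or.inr ⟨w, hw, rfl⟩, Finset.mem_insert_self _ _⟩
    · by_cases hGF : G = F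
      · subst hGF
        obtain ⟨w, hw, hwv⟩ := exists_ne_mem hc v
        exact ⟨_, Or.inr ⟨w, hw, rfl⟩,
          Finset.mem_insert_of_mem (Finset.mem_erase.2 ⟨hwv.symm, hv⟩)⟩
      · exact ⟨G, Or.inl ⟨hGF, hG⟩, hv⟩

end Stack

/-! ### Families of simplices with empty circumspheres -/

section Del

variable {α E : Type*} [DecidableEq α] [NormedAddCommGroup E] [InnerProductSpace ℝ E]

/-- `A` is the affine part of the power function of an empty circumsphere of `F`. -/
def IsEmptySphere (S : Finset (Finset α)) (f : α → E) (F : Finset α) (A : E →ᵃ[ℝ] ℝ) : Prop :=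
  (∀ v ∈ F, pw A (f v) = 0) ∧ ∀ w ∈ verts S, w ∉ F → 0 < pw A (f w)

/-- The simplices of `S`, realized by `f`, are full-dimensional and have empty circumspheres. -/
structure IsDel (S : Finset (Finset α)) (f : α → E) : Prop where
  bary : ∀ F ∈ S, ∃ l, IsBary F f l
  sphere : ∀ F ∈ S, ∃ A, IsEmptySphere S f F A

/-- `A v` is the affine part of the power function of a sphere through `f p` and the `f k`,
`k ∈ τ`, `k ≠ v`, with `f v` outside. -/
structure IsStar (τ : Finset α) (p : α) (f : α → E) (A : α → E →ᵃ[ℝ] ℝ) : Prop where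
  apex : ∀ v ∈ τ, pw (A v) (f p) = 0
  facet : ∀ v ∈ τ, ∀ k ∈ τ, k ≠ v → pw (A v) (f k) = 0
  pos : ∀ v ∈ τ, 0 < pw (A v) (f v)

variable {S : Finset (Finset α)} {F τ : Finset α} {p q a k : α} {f : α → E}
  {A : α → E →ᵃ[ℝ] ℝ} {l : α → E →ᵃ[ℝ] ℝ}

/-- The spheres are the circumspheres of the simplices around `p`. The point `f v` is outside the
one opposite `v` because `v` is a vertex of another of these simplices, which exists as `τ` has two
vertices. -/
lemma IsDel.exists_star (h : IsDel S f) (hp : p ∉ τ) (hc : 2 ≤ τ.card)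
    (hS : ∀ v ∈ τ, insert p (τ.erase v) ∈ S) :
    ∃ A, IsStar τ p f A ∧ ∀ v ∈ τ, IsEmptySphere S f (insert p (τ.erase v)) (A v) := by
  choose! A hA using h.sphere
  refine ⟨fun v => A (insert p (τ.erase v)), ⟨fun v hv => ?_, fun v hv k hk hkv => ?_,
    fun v hv => ?_⟩, fun v hv => hA _ (hS v hv)⟩
  · exact (hA _ (hS v hv)).1 _ (Finset.mem_insert_self _ _)
  · exact (hA _ (hS v hv)).1 _ (Finset.mem_insert_of_mem (Finset.mem_erase.2 ⟨hkv, hk⟩))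
  · obtain ⟨w, hw, hwv⟩ := exists_ne_mem hc v
    refine (hA _ (hS v hv)).2 v (mem_verts.2 ⟨_, hS w hw,
      Finset.mem_insert_of_mem (Finset.mem_erase.2 ⟨hwv.symm, hv⟩)⟩) fun hm => ?_
    rcases Finset.mem_insert.1 hm with rfl | hm
    · exact hp hv
    · exact Finset.notMem_erase _ _ hm

/-- The affine function `A a - A k` vanishes at `f p` and at all `f v` with `v ≠ a, k`. Its values
at `f k` and `f a` are `-pw (A k) (f k)` and `pw (A a) (f a)`; expand the latter in barycentric
coordinates. -/
lemma IsStar.coord_eq (h : IsStar τ p f A) (ha : a ∈ τ) (hl : IsBary (insert p (τ.erase a)) f l)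
    (hk : k ∈ τ) (hka : k ≠ a) : l k (f a) = -(pw (A a) (f a) / pw (A k) (f k)) := by
  have h1 := hl.apply_eq (A a - A k) (f a)
  have hkm : k ∈ insert p (τ.erase a) := Finset.mem_insert_of_mem (Finset.mem_erase.2 ⟨hka, hk⟩)
  rw [← pw_sub_pw, h.facet k hk a ha hka.symm, Finset.sum_eq_single_of_mem k hkm, ← pw_sub_pw,
    h.facet a ha k hk hka] at h1
  · have := (h.pos k hk).ne'
    field_simp
    linarith
  · intro v hv hvk
    rcases Finset.mem_insert.1 hv with rfl | hv
    · rw [← pw_sub_pw, h.apex a ha, h.apex k hk, sub_zero, mul_zero]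
    · have hv' := Finset.mem_erase.1 hv
      rw [← pw_sub_pw, h.facet a ha v hv'.2 hv'.1, h.facet k hk v hv'.2 hvk, sub_zero, mul_zero]

lemma IsStar.coord_neg (h : IsStar τ p f A) (ha : a ∈ τ) (hl : IsBary (insert p (τ.erase a)) f l)
    (hk : k ∈ τ) (hka : k ≠ a) : l k (f a) < 0 := by
  rw [h.coord_eq ha hl hk hka, neg_lt_zero]
  exact div_pos (h.pos a ha) (h.pos k hk)

/-- The apex of a star lies in the interior of the simplex spanned by its boundary. -/
lemma IsStar.exists_bary (h : IsStar τ p f A) (hp : p ∉ τ) (ha : a ∈ τ)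
    (hl : IsBary (insert p (τ.erase a)) f l) :
    ∃ l', IsBary τ f l' ∧ ∀ v ∈ τ, 0 < l' v (f p) := by
  have hpe : p ∉ τ.erase a := fun hh => hp (Finset.mem_of_mem_erase hh)
  -- The coordinates of `f a` sum to 1 and all the others are negative. Hence `a` may be exchanged
  -- for `p`.
  have hpa : 0 < l p (f a) := by
    have h1 := hl.sum_eq (f a)
    rw [Finset.sum_insert hpe] at h1
    have h2 : ∑ v ∈ τ.erase a, l v (f a) ≤ 0 := Finset.sum_nonpos fun k hk =>
      (h.coord_neg ha hl (Finset.mem_of_mem_erase hk) (Finset.ne_of_mem_erase hk)).le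
    linarith
  have h3 := hl.exchange hpe (Finset.notMem_erase a τ) hpa.ne'
  rw [Finset.insert_erase ha] at h3
  refine ⟨_, h3, fun v hv => ?_⟩
  have hp1 := hl.self p (Finset.mem_insert_self _ _)
  by_cases hva : v = a
  · subst hva
    simp [hp1, hpa]
  · have hvm : v ∈ insert p (τ.erase a) := Finset.mem_insert_of_mem (Finset.mem_erase.2 ⟨hva, hv⟩)
    have hv0 := hl.other v hvm p (Finset.mem_insert_self _ _) fun e => hp (e ▸ hv)
    have := h.coord_neg ha hl hv hva
    simp only [hva, if_false, AffineMap.coe_sub, AffineMap.coe_smul, Pi.sub_apply, Pi.smul_apply,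
      hp1, hv0, smul_eq_mul, mul_one, zero_sub, Left.neg_pos_iff]
    exact div_neg_of_neg_of_pos this hpa

/-- Undoing a stellar subdivision preserves empty circumspheres. -/
theorem IsDel.of_stack (h : IsDel (stack S F q) f) (hF : F ∈ S) (hq : q ∉ verts S)
    (hc : 2 ≤ F.card) : IsDel S f := by
  have hqF := notMem_of_notMem_verts hq hF
  have hV := verts_stack (q := q) hF hc
  have hch : ∀ v ∈ F, insert q (F.erase v) ∈ stack S F q := fun v hv => child_mem_stack hv
  obtain ⟨A, hA, hAe⟩ := h.exists_star hqF hc hch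
  obtain ⟨a, ha, -⟩ := exists_ne_mem hc q
  obtain ⟨la, hla⟩ := h.bary _ (hch a ha)
  obtain ⟨l, hl, hlpos⟩ := hA.exists_bary hqF ha hla
  have hne : F.Nonempty := ⟨a, ha⟩
  refine ⟨fun G hG => ?_, fun G hG => ?_⟩
  · by_cases hGF : G = F
    · subst hGF
      exact ⟨l, hl⟩
    · exact h.bary G (mem_stack.2 (Or.inl ⟨hGF, hG⟩))
  · by_cases hGF : G = F
    · subst hGF
      -- Correcting `A v` by a multiple of `l v`, which vanishes on the facet opposite `v`, makes it
      -- vanish at `f v` too. All `B v` therefore describe the circumsphere of the undivided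
      -- simplex.
      let B : α → E →ᵃ[ℝ] ℝ := fun v => A v + (-pw (A v) (f v)) • l v
      have hB0 : ∀ v ∈ G, ∀ w ∈ G, pw (B v) (f w) = 0 := by
        intro v hv w hw
        simp only [B, pw_add_smul]
        by_cases hwv : w = v
        · subst hwv
          rw [hl.self w hw]
          ring
        · rw [hA.facet v hv w hw hwv, hl.other v hv w hw (Ne.symm hwv)]
          ring
      have hBeq : ∀ v ∈ G, ∀ w ∈ G, ∀ y, pw (B v) y = pw (B w) y := by
        intro v hv w hw y
        rw [← sub_eq_zero, pw_sub_pw, hl.apply_eq (B v - B w) y]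
        exact Finset.sum_eq_zero fun k hk => by
          rw [← pw_sub_pw, hB0 v hv k hk, hB0 w hw k hk, sub_zero, mul_zero]
      refine ⟨B a, fun v hv => hB0 a ha v hv, fun w hw hwG => ?_⟩
      have hwq : w ≠ q := fun e => hq (e ▸ hw)
      have hout : ∀ v ∈ G, 0 < pw (A v) (f w) := fun v hv =>
        (hAe v hv).2 w (by rw [hV]; exact Finset.mem_insert_of_mem hw) fun hm => by
          rcases Finset.mem_insert.1 hm with e | hm
          · exact hwq e
          · exact hwG (Finset.mem_of_mem_erase hm)
      -- A further vertex inside the simplex would lie in one of the small simplices, hence in its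
      -- circumball. Otherwise some coordinate `l v` is negative, and there `B v` exceeds the
      -- already positive `A v`.
      by_cases hall : ∀ v ∈ G, 0 ≤ l v (f w)
      · exfalso
        obtain ⟨v, hv, c, hc0, hc1, hcs⟩ := hl.exists_cover hne hqF hlpos hall
        have h1 := pw_sum_smul_le (A v) _ c f hc1 hc0
        rw [hcs, Finset.sum_eq_zero fun k hk => by rw [(hAe v hv).1 k hk, mul_zero]] at h1
        exact absurd (hout v hv) (not_lt.2 h1)
      · push Not at hall
        obtain ⟨v, hv, hlt⟩ := hall
        rw [hBeq a ha v hv]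
        simp only [B, pw_add_smul]
        have := hout v hv
        have := hA.pos v hv
        nlinarith
    · obtain ⟨B, hB⟩ := h.sphere G (mem_stack.2 (Or.inl ⟨hGF, hG⟩))
      exact ⟨B, hB.1, fun w hw => hB.2 w (by rw [hV]; exact Finset.mem_insert_of_mem hw)⟩

end Del

/-! ### The future cone -/

section Cone

variable {E : Type*} [NormedAddCommGroup E] [InnerProductSpace ℝ E]

/-- The Lorentz form on `ℝ × ℝ × E`. -/
def lor (X Y : ℝ × ℝ × E) : ℝ :=
  X.1 * Y.2.1 + X.2.1 * Y.1 - 2 * inner ℝ X.2.2 Y.2.2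

/-- The future cone of the Lorentz form. -/
def IsFuture (X : ℝ × ℝ × E) : Prop :=
  0 ≤ X.1 ∧ 0 ≤ X.2.1 ∧ 0 ≤ lor X X

variable {X Y Z V P N : ℝ × ℝ × E}

lemma lor_comm (X Y : ℝ × ℝ × E) : lor X Y = lor Y X := by
  simp only [lor, real_inner_comm]; ring

lemma lor_add_left (X Y Z : ℝ × ℝ × E) : lor (X + Y) Z = lor X Z + lor Y Z := by
  simp only [lor, Prod.fst_add, Prod.snd_add, inner_add_left]; ring

lemma lor_smul_left (c : ℝ) (X Y : ℝ × ℝ × E) : lor (c • X) Y = c * lor X Y := by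
  simp only [lor, Prod.smul_fst, Prod.smul_snd, inner_smul_left, smul_eq_mul, conj_trivial]; ring

lemma lor_add_right (X Y Z : ℝ × ℝ × E) : lor X (Y + Z) = lor X Y + lor X Z := by
  rw [lor_comm, lor_add_left, lor_comm Y, lor_comm Z]

lemma lor_smul_right (c : ℝ) (X Y : ℝ × ℝ × E) : lor X (c • Y) = c * lor X Y := by
  rw [lor_comm, lor_smul_left, lor_comm]

lemma lor_sub_left (X Y Z : ℝ × ℝ × E) : lor (X - Y) Z = lor X Z - lor Y Z := by
  rw [sub_eq_add_neg, ← neg_one_smul ℝ Y, lor_add_left, lor_smul_left]; ring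

lemma lor_sub_right (X Y Z : ℝ × ℝ × E) : lor X (Y - Z) = lor X Y - lor X Z := by
  rw [lor_comm, lor_sub_left, lor_comm Y, lor_comm Z]

lemma lor_self (X : ℝ × ℝ × E) : lor X X = 2 * (X.1 * X.2.1 - ‖X.2.2‖ ^ 2) := by
  simp only [lor, real_inner_self_eq_norm_sq]; ring

/-- Cauchy–Schwarz for the last components, then the inequality of arithmetic and geometric means
for `X.1 * Y.2.1` and `X.2.1 * Y.1`. -/
lemma IsFuture.lor_nonneg (hX : IsFuture X) (hY : IsFuture Y) : 0 ≤ lor X Y := by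
  obtain ⟨x0, x1, hx⟩ := hX
  obtain ⟨y0, y1, hy⟩ := hY
  rw [lor_self] at hx hy
  have h1 := abs_real_inner_le_norm X.2.2 Y.2.2
  have h2 : (2 * (‖X.2.2‖ * ‖Y.2.2‖)) ^ 2 ≤ (X.1 * Y.2.1 + X.2.1 * Y.1) ^ 2 := by
    have h3 : ‖X.2.2‖ ^ 2 * ‖Y.2.2‖ ^ 2 ≤ (X.1 * X.2.1) * (Y.1 * Y.2.1) :=
      mul_le_mul (by linarith) (by linarith) (sq_nonneg _) (mul_nonneg x0 x1)
    nlinarith [sq_nonneg (X.1 * Y.2.1 - X.2.1 * Y.1)]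
  have h4 := abs_le_of_sq_le_sq h2 (by positivity)
  have h5 := le_abs_self (inner ℝ X.2.2 Y.2.2 : ℝ)
  simp only [lor]
  have h6 := (le_abs_self _).trans h4
  linarith

lemma IsFuture.add (hX : IsFuture X) (hY : IsFuture Y) : IsFuture (X + Y) := by
  refine ⟨add_nonneg hX.1 hY.1, add_nonneg hX.2.1 hY.2.1, ?_⟩
  rw [lor_add_left, lor_add_right, lor_add_right, lor_comm Y X]
  have := hX.lor_nonneg hY
  linarith [hX.2.2, hY.2.2]

lemma IsFuture.smul {c : ℝ} (hc : 0 ≤ c) (hX : IsFuture X) : IsFuture (c • X) := by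
  refine ⟨mul_nonneg hc hX.1, mul_nonneg hc hX.2.1, ?_⟩
  rw [lor_smul_left, lor_smul_right]
  exact mul_nonneg hc (mul_nonneg hc hX.2.2)

lemma isFuture_zero : IsFuture (0 : ℝ × ℝ × E) := by
  simp [IsFuture, lor]

lemma isFuture_sum {ι : Type*} (s : Finset ι) (W : ι → ℝ × ℝ × E) (h : ∀ i ∈ s, IsFuture (W i)) :
    IsFuture (∑ i ∈ s, W i) :=
  Finset.sum_induction W IsFuture (fun _ _ => IsFuture.add) isFuture_zero h

/-- A null vector is future if it pairs positively with a future vector. -/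
lemma isFuture_of_null (h0 : lor Z Z = 0) (hV : IsFuture V) (h : 0 < lor Z V) : IsFuture Z := by
  by_contra hn
  have h1 : Z.1 * Z.2.1 = ‖Z.2.2‖ ^ 2 := by
    rw [lor_self] at h0
    linarith
  -- The first two components of a null vector have nonnegative product, so either it or its
  -- negative is future; the negative cannot pair negatively with `V`.
  have h2 : IsFuture ((-1 : ℝ) • Z) := by
    have h3 : lor ((-1 : ℝ) • Z) ((-1 : ℝ) • Z) = 0 := by
      rw [lor_smul_left, lor_smul_right, h0]; ring
    have h4 : 0 ≤ Z.1 * Z.2.1 := h1 ▸ sq_nonneg _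
    have h5 : ¬ (0 ≤ Z.1 ∧ 0 ≤ Z.2.1) := fun hh => hn ⟨hh.1, hh.2, h0.ge⟩
    refine ⟨?_, ?_, h3.ge⟩
    all_goals
      simp only [Prod.smul_fst, Prod.smul_snd, smul_eq_mul, neg_one_mul, Left.nonneg_neg_iff]
      by_contra hlt
      push Not at hlt
      apply h5
    · exact ⟨hlt.le, by by_contra hh; push Not at hh; nlinarith⟩
    · exact ⟨by by_contra hh; push Not at hh; nlinarith, hlt.le⟩
  have h6 := h2.lor_nonneg hV
  rw [lor_smul_left] at h6
  linarith

/-- If `X + Y - β V` is null then so is `X - β' V` for some `β' ≤ β`. -/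
lemma exists_null_sub (hY : IsFuture Y) (hV : IsFuture V) (hV0 : lor V V = 0) {β : ℝ}
    (hX0 : 0 < lor X X) (hXV : 0 < lor X V) (h : lor (X + Y - β • V) (X + Y - β • V) = 0) :
    ∃ β', 0 < β' ∧ β' ≤ β ∧ lor (X - β' • V) (X - β' • V) = 0 ∧ IsFuture (X - β' • V) := by
  -- As `V` is null, `lor (X - t • V) (X - t • V)` is affine in `t`; this is its root.
  set β' := lor X X / (2 * lor X V) with hβ
  have hβ0 : 0 < β' := by positivity
  have hm : β' * (2 * lor X V) = lor X X := div_mul_cancel₀ _ (by positivity)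
  have hZ0 : lor (X - β' • V) (X - β' • V) = 0 := by
    simp only [lor_sub_left, lor_sub_right, lor_smul_left, lor_smul_right, hV0, lor_comm V X]
    linarith
  have hZV : 0 < lor (X - β' • V) V := by
    rw [lor_sub_left, lor_smul_left, hV0]
    linarith
  have hZ := isFuture_of_null hZ0 hV hZV
  refine ⟨β', hβ0, ?_, hZ0, hZ⟩
  have h1 := hZ.lor_nonneg hY
  rw [lor_sub_left, lor_smul_left] at h1
  have hYV : 0 ≤ lor Y V := hY.lor_nonneg hV
  have hYY := hY.2.2
  simp only [lor_sub_left, lor_sub_right, lor_add_left, lor_add_right, lor_smul_left,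
    lor_smul_right, hV0, lor_comm V X, lor_comm V Y, lor_comm Y X] at h
  rw [lor_comm V Y] at h1
  -- With `Z = X - β' • V` the given null vector is `Z + Y + (β' - β) • V`. For `β < β'` this is a
  -- sum of future vectors in which `Z` and `V` pair positively, so it cannot be null.
  by_contra hlt
  push Not at hlt
  nlinarith

/-- The crucial inequality for one of the four simplices stacked onto a simplex. -/
lemma lor_le_of_stacked {Vi Vj Vk Q : ℝ × ℝ × E} {δ b c : ℝ} (hP : lor P P = 0)
    (hj : lor Vj Vj = 0) (hk : lor Vk Vk = 0) (hN : lor N N = 0) (hPf : IsFuture P)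
    (hNe : P = Vi + Vj + Vk - N) (hQ : Q = δ • P + b • Vj + c • Vk - Vi) (hQ0 : lor Q Q = 0)
    (hQf : IsFuture Q) (hδ : 1 ≤ δ) (hb : 0 < b) (hc : 0 < c) :
    lor Vj Vk ≤ lor N Vj * (1 / (1 + c)) + lor N Vk * (1 / (1 + b)) := by
  have hQP := hQf.lor_nonneg hPf
  -- Lowering the coefficient of `P` to 1 makes the self-product `-2 * (δ - 1) * lor Q P ≤ 0`.
  -- Writing `P` through `N` then cancels `Vi`, so only `Vj`, `Vk` and `N` are left.
  set U := Q - (δ - 1) • P with hU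
  have hU1 : lor U U ≤ 0 := by
    rw [hU]
    simp only [lor_sub_left, lor_sub_right, lor_smul_left, lor_smul_right, hP, hQ0, lor_comm P Q]
    nlinarith
  have hU2 : U = (1 + b) • Vj + (1 + c) • Vk - N := by
    rw [hU, hQ, sub_smul, one_smul, hNe]
    module
  rw [hU2] at hU1
  simp only [lor_sub_left, lor_sub_right, lor_add_left, lor_add_right, lor_smul_left,
    lor_smul_right, hj, hk, hN, lor_comm Vk Vj, lor_comm Vj N, lor_comm Vk N] at hU1
  have h1 : (1 + b) * (1 + c) * lor Vj Vk ≤ (1 + b) * lor N Vj + (1 + c) * lor N Vk := by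
    linarith
  have h2 : lor N Vj * (1 / (1 + c)) + lor N Vk * (1 / (1 + b))
      = ((1 + b) * lor N Vj + (1 + c) * lor N Vk) / ((1 + b) * (1 + c)) := by
    field_simp
  rw [h2, le_div_iff₀ (by positivity)]
  linarith

lemma inv_add_inv_lt {b c : ℝ} (hb : 0 < b) (hc : 0 < c) (h : 1 < b * c) :
    1 / (1 + b) + 1 / (1 + c) < 1 := by
  rw [div_add_div _ _ (by positivity) (by positivity), div_lt_one (by positivity)]
  nlinarith

/-- An ideal simplex cannot be stacked convexly on four facets. -/
lemma not_four_stacked {V0 V1 V2 Q0 Q1 Q2 : ℝ × ℝ × E} {δ0 δ1 δ2 b01 b02 b10 b12 b20 b21 : ℝ}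
    (hP : lor P P = 0) (h0 : lor V0 V0 = 0) (h1 : lor V1 V1 = 0) (h2 : lor V2 V2 = 0)
    (hPf : IsFuture P) (h0f : IsFuture V0) (h1f : IsFuture V1) (h2f : IsFuture V2)
    (hD : 0 < lor V0 V1) (hNe : N = V0 + V1 + V2 - P) (hN : lor N N = 0) (hNf : IsFuture N)
    (hQ0 : Q0 = δ0 • P + b01 • V1 + b02 • V2 - V0) (hQ00 : lor Q0 Q0 = 0) (hQ0f : IsFuture Q0)
    (hQ1 : Q1 = δ1 • P + b10 • V0 + b12 • V2 - V1) (hQ10 : lor Q1 Q1 = 0) (hQ1f : IsFuture Q1)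
    (hQ2 : Q2 = δ2 • P + b20 • V0 + b21 • V1 - V2) (hQ20 : lor Q2 Q2 = 0) (hQ2f : IsFuture Q2)
    (hδ0 : 1 ≤ δ0) (hδ1 : 1 ≤ δ1) (hδ2 : 1 ≤ δ2) (p01 : 0 < b01) (p02 : 0 < b02) (p10 : 0 < b10)
    (p12 : 0 < b12) (p20 : 0 < b20) (p21 : 0 < b21) (h01 : 1 < b01 * b10) (h02 : 1 < b02 * b20)
    (h12 : 1 < b12 * b21) : False := by
  have e0 := lor_le_of_stacked (Vi := V0) hP h1 h2 hN hPf (by rw [hNe]; abel) hQ0 hQ00 hQ0f hδ0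
    p01 p02
  have e1 := lor_le_of_stacked (Vi := V1) hP h0 h2 hN hPf (by rw [hNe]; abel) hQ1 hQ10 hQ1f hδ1
    p10 p12
  have e2 := lor_le_of_stacked (Vi := V2) hP h0 h1 hN hPf (by rw [hNe]; abel) hQ2 hQ20 hQ2f hδ2
    p20 p21
  have hPe : P = V0 + V1 + V2 - N := by rw [hNe]; abel
  -- This is the nullity of `P`, with `P` expressed by the other four vectors.
  have hsum : lor V0 V1 + lor V0 V2 + lor V1 V2 = lor N V0 + lor N V1 + lor N V2 := by
    rw [hPe] at hP
    simp only [lor_sub_left, lor_sub_right, lor_add_left, lor_add_right, h0, h1, h2, hN,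
      lor_comm V0 N, lor_comm V1 N, lor_comm V2 N, lor_comm V1 V0, lor_comm V2 V0,
      lor_comm V2 V1] at hP
    linarith
  have n0 := hNf.lor_nonneg h0f
  have n1 := hNf.lor_nonneg h1f
  have n2 := hNf.lor_nonneg h2f
  have d02 := h0f.lor_nonneg h2f
  have d12 := h1f.lor_nonneg h2f
  have i01 := inv_add_inv_lt p01 p10 h01
  have i02 := inv_add_inv_lt p02 p20 h02
  have i12 := inv_add_inv_lt p12 p21 h12
  -- The sum of the three inequalities combined with `hsum`. Every bracket is positive by convexity
  -- across an edge, so all products with `N` vanish; then `hsum` contradicts `lor V0 V1 > 0`.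
  have key : lor N V0 * (1 - (1 / (1 + b12) + 1 / (1 + b21)))
      + lor N V1 * (1 - (1 / (1 + b02) + 1 / (1 + b20)))
      + lor N V2 * (1 - (1 / (1 + b01) + 1 / (1 + b10))) ≤ 0 := by
    linarith
  have k0 := mul_nonneg n0 (sub_nonneg.2 i12.le)
  have k1 := mul_nonneg n1 (sub_nonneg.2 i02.le)
  have k2 := mul_nonneg n2 (sub_nonneg.2 i01.le)
  have z0 : lor N V0 = 0 :=
    (mul_eq_zero.1 (le_antisymm (by linarith) k0)).resolve_right (sub_pos.2 i12).ne'
  have z1 : lor N V1 = 0 :=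
    (mul_eq_zero.1 (le_antisymm (by linarith) k1)).resolve_right (sub_pos.2 i02).ne'
  have z2 : lor N V2 = 0 :=
    (mul_eq_zero.1 (le_antisymm (by linarith) k2)).resolve_right (sub_pos.2 i01).ne'
  linarith

/-- The null vector of a point. -/
def nullVec (z : E) : ℝ × ℝ × E := (1, ‖z‖ ^ 2, z)

lemma lor_nullVec (y z : E) : lor (nullVec y) (nullVec z) = ‖y - z‖ ^ 2 := by
  simp only [lor, nullVec, norm_sub_sq_real]; ring

lemma lor_nullVec_self (z : E) : lor (nullVec z) (nullVec z) = 0 := by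
  simp [lor_nullVec]

lemma isFuture_nullVec (z : E) : IsFuture (nullVec z) :=
  ⟨zero_le_one, sq_nonneg _, (lor_nullVec_self z).ge⟩

lemma sum_smul_nullVec {ι : Type*} (s : Finset ι) (c : ι → ℝ) (z : ι → E) :
    ∑ i ∈ s, c i • nullVec (z i)
      = (∑ i ∈ s, c i, ∑ i ∈ s, c i * ‖z i‖ ^ 2, ∑ i ∈ s, c i • z i) := by
  refine Prod.ext ?_ (Prod.ext ?_ ?_)
  · simp [Prod.fst_sum, nullVec]
  · simp [Prod.snd_sum, Prod.fst_sum, nullVec]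
  · simp [Prod.snd_sum, nullVec]

lemma sum_split {ι M : Type*} [DecidableEq ι] [AddCommMonoid M] {s : Finset ι} {i j k : ι}
    (hi : i ∈ s) (hj : j ∈ s) (hk : k ∈ s) (hij : i ≠ j) (hik : i ≠ k) (hjk : j ≠ k) (g : ι → M) :
    ∑ m ∈ s, g m = g i + (g j + (g k + ∑ m ∈ ((s.erase i).erase j).erase k, g m)) := by
  rw [Finset.add_sum_erase _ g, Finset.add_sum_erase _ g, Finset.add_sum_erase _ g hi]
  · simp [hj, hij.symm]
  · simp [hk, hjk.symm, hik.symm]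

/-! ### Reduction to an ideal tetrahedron. -/

section Reduce

variable {ι : Type*} [DecidableEq ι] {s : Finset ι} {z : ι → E} {i j k : ι}

/-- Project the null vector of a point stacked beyond the facet opposite to `z i` to the span of
the null vectors of `0`, `z i`, `z j`, `z k`. -/
lemma exists_reduce {b : ι → ℝ} {y : E} (hi : i ∈ s) (hj : j ∈ s) (hk : k ∈ s) (hij : i ≠ j)
    (hik : i ≠ k) (hjk : j ≠ k) (hz : ∀ m ∈ s, z m ≠ 0) (hinj : Set.InjOn z s)
    (hb : ∀ m ∈ s, m ≠ i → 0 < b m) (hby : ∑ m ∈ s, b m • z m = y)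
    (hby2 : ∑ m ∈ s, b m * ‖z m‖ ^ 2 = ‖y‖ ^ 2) (hδ : 0 < 1 - ∑ m ∈ s, b m) :
    ∃ β Q, 0 < β ∧ β ≤ -b i ∧ lor Q Q = 0 ∧ IsFuture Q ∧
      Q = (1 - ∑ m ∈ s, b m) • nullVec 0 + b j • nullVec (z j) + b k • nullVec (z k)
        - β • nullVec (z i) := by
  set δ := 1 - ∑ m ∈ s, b m with hδe
  set r := ((s.erase i).erase j).erase k with hr
  have hbj := hb j hj hij.symm
  have hbk := hb k hk hik.symm
  have hnz : ∀ m ∈ s, 0 < lor (nullVec 0) (nullVec (z m)) := fun m hm => by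
    rw [lor_nullVec, zero_sub, norm_neg]
    have := norm_pos_iff.2 (hz m hm)
    positivity
  have hnn : ∀ m ∈ s, ∀ m' ∈ s, m ≠ m' → 0 < lor (nullVec (z m)) (nullVec (z m')) :=
    fun m hm m' hm' hne => by
      rw [lor_nullVec]
      have := norm_pos_iff.2 (sub_ne_zero.2 (hinj.ne hm hm' hne))
      positivity
  -- The lifted form of the relation for `y`: `hby2` and `hby` match the last two components, and
  -- `nullVec 0` makes up for the defect `δ` in the first.
  have hdec : nullVec y = δ • nullVec 0 + b j • nullVec (z j) + b k • nullVec (z k)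
      + ∑ m ∈ r, b m • nullVec (z m) - (-b i) • nullVec (z i) := by
    have h1 := sum_split hi hj hk hij hik hjk fun m => b m • nullVec (z m)
    rw [sum_smul_nullVec s b z, hby, hby2] at h1
    have h2 : nullVec y = δ • nullVec 0 + (∑ i ∈ s, b i, ‖y‖ ^ 2, y) := by
      refine Prod.ext ?_ (Prod.ext ?_ ?_) <;> simp [nullVec, hδe]
    rw [h2, h1]
    module
  have hXX : 0 < lor (δ • nullVec 0 + b j • nullVec (z j) + b k • nullVec (z k))
      (δ • nullVec 0 + b j • nullVec (z j) + b k • nullVec (z k)) := by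
    simp only [lor_add_left, lor_add_right, lor_smul_left, lor_smul_right, lor_nullVec_self,
      lor_comm (nullVec (z j)) (nullVec 0), lor_comm (nullVec (z k)) (nullVec 0),
      lor_comm (nullVec (z k)) (nullVec (z j))]
    have h1 := hnz j hj
    have h2 := hnz k hk
    have h3 := hnn j hj k hk hjk
    have := mul_pos (mul_pos hδ hbj) h1
    have := mul_pos (mul_pos hδ hbk) h2
    have := mul_pos (mul_pos hbj hbk) h3
    linarith
  have hXV : 0 < lor (δ • nullVec 0 + b j • nullVec (z j) + b k • nullVec (z k))
      (nullVec (z i)) := by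
    simp only [lor_add_left, lor_smul_left]
    have h1 := hnz i hi
    have h2 := hnn j hj i hi hij.symm
    have h3 := hnn k hk i hi hik.symm
    positivity
  have hY : IsFuture (∑ m ∈ r, b m • nullVec (z m)) := isFuture_sum _ _ fun m hm => by
    simp only [hr, Finset.mem_erase] at hm
    exact (isFuture_nullVec _).smul (hb m hm.2.2.2 hm.2.2.1).le
  obtain ⟨β, h1, h2, h3, h4⟩ := exists_null_sub hY (isFuture_nullVec (z i)) (lor_nullVec_self _)
    hXX hXV (hdec ▸ lor_nullVec_self y)
  exact ⟨β, _, h1, h2, h3, h4, rfl⟩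

/-- Project the null vector of infinity to the span of the null vectors of `0`, `z i`, `z j`,
`z k`. -/
lemma exists_reduce_infty {c : ι → ℝ} (hi : i ∈ s) (hj : j ∈ s) (hk : k ∈ s) (hij : i ≠ j)
    (hik : i ≠ k) (hjk : j ≠ k) (hz : ∀ m ∈ s, z m ≠ 0) (hinj : Set.InjOn z s)
    (hc : ∀ m ∈ s, 0 < c m) (hc0 : ∑ m ∈ s, c m • z m = 0) :
    ∃ β N, 0 < β ∧ β ≤ ∑ m ∈ s, c m ∧ lor N N = 0 ∧ IsFuture N ∧
      N = c i • nullVec (z i) + c j • nullVec (z j) + c k • nullVec (z k) - β • nullVec 0 := by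
  set r := ((s.erase i).erase j).erase k with hr
  have hnz : ∀ m ∈ s, 0 < lor (nullVec (z m)) (nullVec 0) := fun m hm => by
    rw [lor_nullVec, sub_zero]
    have := norm_pos_iff.2 (hz m hm)
    positivity
  have hnn : ∀ m ∈ s, ∀ m' ∈ s, m ≠ m' → 0 < lor (nullVec (z m)) (nullVec (z m')) :=
    fun m hm m' hm' hne => by
      rw [lor_nullVec]
      have := norm_pos_iff.2 (sub_ne_zero.2 (hinj.ne hm hm' hne))
      positivity
  -- The left side is a multiple of the null vector of the point at infinity.
  have hdec : ((0, ∑ m ∈ s, c m * ‖z m‖ ^ 2, 0) : ℝ × ℝ × E)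
      = c i • nullVec (z i) + c j • nullVec (z j) + c k • nullVec (z k)
      + ∑ m ∈ r, c m • nullVec (z m) - (∑ m ∈ s, c m) • nullVec 0 := by
    have h1 := sum_split hi hj hk hij hik hjk fun m => c m • nullVec (z m)
    rw [sum_smul_nullVec s c z, hc0] at h1
    have h2 : ((0, ∑ m ∈ s, c m * ‖z m‖ ^ 2, 0) : ℝ × ℝ × E)
        = (∑ i ∈ s, c i, ∑ m ∈ s, c m * ‖z m‖ ^ 2, 0) - (∑ m ∈ s, c m) • nullVec 0 := by
      refine Prod.ext ?_ (Prod.ext ?_ ?_) <;> simp [nullVec]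
    rw [h2, h1]
    module
  have ci := hc i hi
  have cj := hc j hj
  have ck := hc k hk
  have hXX : 0 < lor (c i • nullVec (z i) + c j • nullVec (z j) + c k • nullVec (z k))
      (c i • nullVec (z i) + c j • nullVec (z j) + c k • nullVec (z k)) := by
    simp only [lor_add_left, lor_add_right, lor_smul_left, lor_smul_right, lor_nullVec_self,
      lor_comm (nullVec (z j)) (nullVec (z i)), lor_comm (nullVec (z k)) (nullVec (z i)),
      lor_comm (nullVec (z k)) (nullVec (z j))]
    have := mul_pos (mul_pos ci cj) (hnn i hi j hj hij)
    have := mul_pos (mul_pos ci ck) (hnn i hi k hk hik)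
    have := mul_pos (mul_pos cj ck) (hnn j hj k hk hjk)
    linarith
  have hXV : 0 < lor (c i • nullVec (z i) + c j • nullVec (z j) + c k • nullVec (z k))
      (nullVec 0) := by
    simp only [lor_add_left, lor_smul_left]
    have := hnz i hi
    have := hnz j hj
    have := hnz k hk
    positivity
  have hY : IsFuture (∑ m ∈ r, c m • nullVec (z m)) := isFuture_sum _ _ fun m hm => by
    simp only [hr, Finset.mem_erase] at hm
    exact (isFuture_nullVec _).smul (hc m hm.2.2.2).le
  obtain ⟨β, h1, h2, h3, h4⟩ := exists_null_sub hY (isFuture_nullVec 0) (lor_nullVec_self _)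
    hXX hXV (by rw [← hdec]; simp [lor])
  exact ⟨β, _, h1, h2, h3, h4, rfl⟩

/-- The points `z m` have the origin in the interior of their convex hull, witnessed by the
weights `c`. It is impossible that three of the simplices spanned by the origin and the facets
of the simplex are subdivided by points `∑ m, b i m • z m` in a locally Delaunay manner. -/
theorem not_three_stacked {c : ι → ℝ} {b : ι → ι → ℝ} {y : ι → E} (hi : i ∈ s) (hj : j ∈ s)
    (hk : k ∈ s) (hij : i ≠ j) (hik : i ≠ k) (hjk : j ≠ k) (hz : ∀ m ∈ s, z m ≠ 0)
    (hinj : Set.InjOn z s) (hc : ∀ m ∈ s, 0 < c m) (hc0 : ∑ m ∈ s, c m • z m = 0)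
    (hb : ∀ a ∈ ({i, j, k} : Set ι), ∀ m ∈ s, m ≠ a → 0 < b a m)
    (hby : ∀ a ∈ ({i, j, k} : Set ι), ∑ m ∈ s, b a m • z m = y a)
    (hby2 : ∀ a ∈ ({i, j, k} : Set ι), ∑ m ∈ s, b a m * ‖z m‖ ^ 2 = ‖y a‖ ^ 2)
    (hδ0 : ∀ a ∈ ({i, j, k} : Set ι), 0 < 1 - ∑ m ∈ s, b a m)
    (hδ : ∀ a ∈ ({i, j, k} : Set ι), -b a a * ∑ m ∈ s, c m ≤ c a * (1 - ∑ m ∈ s, b a m))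
    (hpair : ∀ a ∈ ({i, j, k} : Set ι), ∀ a' ∈ ({i, j, k} : Set ι), a ≠ a' →
      b a a * b a' a' < b a a' * b a' a) : False := by
  have mi : i ∈ ({i, j, k} : Set ι) := by simp
  have mj : j ∈ ({i, j, k} : Set ι) := by simp
  have mk : k ∈ ({i, j, k} : Set ι) := by simp
  obtain ⟨Λ, N, hΛ, hΛ', hN, hNf, hNe⟩ := exists_reduce_infty hi hj hk hij hik hjk hz hinj hc hc0
  obtain ⟨βi, Qi, hβi, hβi', hQi, hQif, hQie⟩ := exists_reduce hi hj hk hij hik hjk hz hinj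
    (hb i mi) (hby i mi) (hby2 i mi) (hδ0 i mi)
  obtain ⟨βj, Qj, hβj, hβj', hQj, hQjf, hQje⟩ := exists_reduce hj hi hk hij.symm hjk hik hz hinj
    (hb j mj) (hby j mj) (hby2 j mj) (hδ0 j mj)
  obtain ⟨βk, Qk, hβk, hβk', hQk, hQkf, hQke⟩ := exists_reduce hk hi hj hik.symm hjk.symm hij hz
    hinj (hb k mk) (hby k mk) (hby2 k mk) (hδ0 k mk)
  have ci := hc i hi
  have cj := hc j hj
  have ck := hc k hk
  have hnull : ∀ (t : ℝ) (x : E), lor (t • nullVec x) (t • nullVec x) = 0 := fun t x => by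
    rw [lor_smul_left, lor_smul_right, lor_nullVec_self, mul_zero, mul_zero]
  have hQnull : ∀ (t : ℝ) (Q : ℝ × ℝ × E), lor Q Q = 0 → lor (t • Q) (t • Q) = 0 :=
    fun t Q hQ => by rw [lor_smul_left, lor_smul_right, hQ, mul_zero, mul_zero]
  -- The reductions only shrink `-b a a` to `β` and `∑ c` to `Λ`, which is the direction that
  -- preserves both convexity inequalities.
  have hδ' : ∀ a ∈ ({i, j, k} : Set ι), ∀ β, 0 < β → β ≤ -b a a →
      1 ≤ c a / β * (1 - ∑ m ∈ s, b a m) / Λ := fun a ha β hβ hβ' => by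
    have h1 := hδ a ha
    have h2 : β * Λ ≤ -b a a * ∑ m ∈ s, c m := mul_le_mul hβ' hΛ' hΛ.le (hβ.le.trans hβ')
    rw [le_div_iff₀ hΛ, one_mul, div_mul_eq_mul_div, le_div_iff₀ hβ]
    linarith
  have hpair' : ∀ a ∈ ({i, j, k} : Set ι), ∀ a' ∈ ({i, j, k} : Set ι), a ≠ a' →
      0 < c a → 0 < c a' → ∀ β, 0 < β → β ≤ -b a a → ∀ β', 0 < β' → β' ≤ -b a' a' →
      1 < (c a / β * b a a' / c a') * (c a' / β' * b a' a / c a) := by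
    intro a ha a' ha' hne p p' β hβ hβb β' hβ' hβb'
    have h1 := hpair a ha a' ha' hne
    have h2 : β * β' ≤ -b a a * -b a' a' := mul_le_mul hβb hβb' hβ'.le (hβ.le.trans hβb)
    have h3 : (c a / β * b a a' / c a') * (c a' / β' * b a' a / c a)
        = b a a' * b a' a / (β * β') := by
      field_simp
    rw [h3, lt_div_iff₀ (by positivity)]
    linarith
  have q : ∀ a ∈ ({i, j, k} : Set ι), ∀ m ∈ s, m ≠ a → 0 < c a → 0 < c m → ∀ β, 0 < β →
      0 < c a / β * b a m / c m := fun a ha m hm hma p p' β hβ => by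
    have := hb a ha m hm hma
    positivity
  -- The scaling of the vertices by `c` and `Λ` makes all coefficients of `N` equal to `±1`; scaling
  -- `Q` by `c a / β` makes its coefficient at the opposite vertex `-1`.
  refine not_four_stacked (P := Λ • nullVec 0) (V0 := c i • nullVec (z i))
    (V1 := c j • nullVec (z j)) (V2 := c k • nullVec (z k)) (N := N) (Q0 := (c i / βi) • Qi)
    (Q1 := (c j / βj) • Qj) (Q2 := (c k / βk) • Qk) (hnull _ _) (hnull _ _) (hnull _ _)
    (hnull _ _) ((isFuture_nullVec _).smul hΛ.le) ((isFuture_nullVec _).smul ci.le)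
    ((isFuture_nullVec _).smul cj.le) ((isFuture_nullVec _).smul ck.le) ?_ hNe hN hNf
    ?_ (hQnull _ _ hQi) (hQif.smul (by positivity))
    ?_ (hQnull _ _ hQj) (hQjf.smul (by positivity))
    ?_ (hQnull _ _ hQk) (hQkf.smul (by positivity))
    (hδ' i mi βi hβi hβi') (hδ' j mj βj hβj hβj') (hδ' k mk βk hβk hβk')
    (q i mi j hj hij.symm ci cj βi hβi) (q i mi k hk hik.symm ci ck βi hβi)
    (q j mj i hi hij cj ci βj hβj) (q j mj k hk hjk.symm cj ck βj hβj)
    (q k mk i hi hik ck ci βk hβk) (q k mk j hj hjk ck cj βk hβk)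
    (hpair' i mi j mj hij ci cj βi hβi hβi' βj hβj hβj')
    (hpair' i mi k mk hik ci ck βi hβi hβi' βk hβk hβk')
    (hpair' j mj k mk hjk cj ck βj hβj hβj' βk hβk hβk')
  · rw [lor_smul_left, lor_smul_right, lor_nullVec]
    have := norm_pos_iff.2 (sub_ne_zero.2 (hinj.ne hi hj hij))
    positivity
  · rw [hQie]
    simp only [smul_sub, smul_add, smul_smul]
    rw [div_mul_cancel₀ _ hβi.ne', div_mul_cancel₀ _ hΛ.ne', div_mul_cancel₀ _ cj.ne',
      div_mul_cancel₀ _ ck.ne']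
  · rw [hQje]
    simp only [smul_sub, smul_add, smul_smul]
    rw [div_mul_cancel₀ _ hβj.ne', div_mul_cancel₀ _ hΛ.ne', div_mul_cancel₀ _ ci.ne',
      div_mul_cancel₀ _ ck.ne']
  · rw [hQke]
    simp only [smul_sub, smul_add, smul_smul]
    rw [div_mul_cancel₀ _ hβk.ne', div_mul_cancel₀ _ hΛ.ne', div_mul_cancel₀ _ ci.ne',
      div_mul_cancel₀ _ cj.ne']

end Reduce

end Cone

/-! ### Three subdivided neighbours of an interior vertex -/

section Three

variable {α E : Type*} [DecidableEq α] [NormedAddCommGroup E] [InnerProductSpace ℝ E]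
  {τ : Finset α} {p a m : α} {f : α → E} {A : α → E →ᵃ[ℝ] ℝ} {l : α → E →ᵃ[ℝ] ℝ}

lemma IsBary.sum_smul_sub (hl : IsBary (insert p (τ.erase a)) f l) (hp : p ∉ τ) (y : E) :
    ∑ m ∈ τ.erase a, l m y • (f m - f p) = y - f p := by
  have hpe : p ∉ τ.erase a := fun hh => hp (Finset.mem_of_mem_erase hh)
  have h1 := hl.sum_smul y
  have h2 := hl.sum_eq y
  rw [Finset.sum_insert hpe] at h1 h2
  simp only [smul_sub, Finset.sum_sub_distrib, ← Finset.sum_smul]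
  rw [eq_sub_of_add_eq' h1, eq_sub_of_add_eq' h2]
  module

/-- A power function vanishing at the apex, in terms of a linear functional. -/
lemma pw_eq_of_apex {B : E →ᵃ[ℝ] ℝ} {x : E} (h : pw B x = 0) (y : E) :
    pw B y = ‖y - x‖ ^ 2 + (2 • innerₗ E x + B.linear) (y - x) := by
  have h1 := pw_add_smul_vec B x (y - x) 1
  rw [one_smul, add_sub_cancel, h] at h1
  rw [h1]
  simp only [LinearMap.add_apply, LinearMap.smul_apply, innerₗ_apply_apply, nsmul_eq_mul]
  push_cast
  ring

namespace IsStar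

/-- `B - A a` is affine and vanishes at every vertex of the simplex opposite `a` except `m`, so it
is a multiple of `l m`. -/
lemma pw_eq_add (h : IsStar τ p f A) (ha : a ∈ τ) (hl : IsBary (insert p (τ.erase a)) f l)
    (hm : m ∈ τ) (hma : m ≠ a) {B : E →ᵃ[ℝ] ℝ} (hBp : pw B (f p) = 0)
    (hB : ∀ v ∈ τ, v ≠ a → v ≠ m → pw B (f v) = 0) (y : E) :
    pw B y = pw (A a) y + l m y * pw B (f m) := by
  have h1 := hl.apply_eq (B - A a) y
  have hmm : m ∈ insert p (τ.erase a) := Finset.mem_insert_of_mem (Finset.mem_erase.2 ⟨hma, hm⟩)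
  rw [← pw_sub_pw, Finset.sum_eq_single_of_mem m hmm, ← pw_sub_pw, h.facet a ha m hm hma] at h1
  · linarith
  · intro v hv hvm
    rcases Finset.mem_insert.1 hv with rfl | hv
    · rw [← pw_sub_pw, h.apex a ha, hBp, sub_zero, mul_zero]
    · have hv' := Finset.mem_erase.1 hv
      rw [← pw_sub_pw, h.facet a ha v hv'.2 hv'.1, hB v hv'.2 hv'.1 hvm, sub_zero, mul_zero]

/-- On lifted points each `pw (A m)` is a linear functional, zero at the lifts of `p` and of the
vertices other than `m`, and 1 at the vector `(0, 1, 0)` of infinity. So the inverses of `pw (A m)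
(f m)` are the coordinates of infinity; this is the spatial component of that fact, and
`sum_inv_mul` the quadratic one. -/
lemma sum_inv_smul (h : IsStar τ p f A) (hp : p ∉ τ) (ha : a ∈ τ)
    (hl : IsBary (insert p (τ.erase a)) f l) :
    ∑ m ∈ τ, (pw (A m) (f m))⁻¹ • (f m - f p) = 0 := by
  have h1 := hl.sum_smul_sub hp (f a)
  rw [← Finset.add_sum_erase _ _ ha]
  have h2 : ∑ m ∈ τ.erase a, (pw (A m) (f m))⁻¹ • (f m - f p)
      = -(pw (A a) (f a))⁻¹ • ∑ m ∈ τ.erase a, l m (f a) • (f m - f p) := by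
    rw [Finset.smul_sum]
    refine Finset.sum_congr rfl fun m hm => ?_
    have hm' := Finset.mem_erase.1 hm
    rw [h.coord_eq ha hl hm'.2 hm'.1, smul_smul]
    have := (h.pos a ha).ne'
    congr 1
    field_simp
  rw [h2, h1]
  module

lemma sum_inv_mul (h : IsStar τ p f A) (hp : p ∉ τ) (ha : a ∈ τ)
    (hl : IsBary (insert p (τ.erase a)) f l) :
    ∑ m ∈ τ, (pw (A m) (f m))⁻¹ * ‖f m - f p‖ ^ 2 = 1 := by
  set D := 2 • innerₗ E (f p) + (A a).linear with hD
  have h1 : ∑ m ∈ τ, (pw (A m) (f m))⁻¹ * D (f m - f p) = 0 := by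
    have := congrArg D (h.sum_inv_smul hp ha hl)
    simpa only [map_sum, map_smul, smul_eq_mul, map_zero] using this
  have h2 : ∀ m ∈ τ, (pw (A m) (f m))⁻¹ * ‖f m - f p‖ ^ 2
      = (pw (A m) (f m))⁻¹ * pw (A a) (f m) - (pw (A m) (f m))⁻¹ * D (f m - f p) := by
    intro m _
    rw [pw_eq_of_apex (h.apex a ha) (f m)]
    ring
  rw [Finset.sum_congr rfl h2, Finset.sum_sub_distrib, h1, sub_zero,
    Finset.sum_eq_single_of_mem a ha, inv_mul_cancel₀ (h.pos a ha).ne']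
  intro m hm hma
  rw [h.facet a ha m hm hma, mul_zero]

/-- At most two of the simplices around an interior vertex of a Delaunay triangulation arising
from a single stellar subdivision can be subdivided. -/
theorem not_three {i j k : α} {q : α → α} {B : α → α → E →ᵃ[ℝ] ℝ} (h : IsStar τ p f A)
    (hp : p ∉ τ) (hi : i ∈ τ) (hj : j ∈ τ) (hk : k ∈ τ) (hij : i ≠ j) (hik : i ≠ k) (hjk : j ≠ k)
    (hB : ∀ a ∈ ({i, j, k} : Set α), IsStar (insert p (τ.erase a)) (q a) f (B a))
    (hBa : ∀ a ∈ ({i, j, k} : Set α), ∀ m ∈ τ, m ≠ a → 0 < pw (B a m) (f a))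
    (hint : ∀ a ∈ ({i, j, k} : Set α), ∃ l, IsBary (insert p (τ.erase a)) f l ∧
      ∀ v ∈ insert p (τ.erase a), 0 < l v (f (q a)))
    (hpair : ∀ a ∈ ({i, j, k} : Set α), ∀ a' ∈ ({i, j, k} : Set α), a ≠ a' →
      0 < pw (B a a') (f (q a')) ∨ 0 < pw (B a' a) (f (q a))) : False := by
  have hsub : ∀ a ∈ ({i, j, k} : Set α), a ∈ τ := by
    rintro a (rfl | rfl | rfl) <;> assumption
  have hoth : ∀ a ∈ ({i, j, k} : Set α), ∃ m ∈ τ, m ≠ a := by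
    rintro a (rfl | rfl | rfl)
    · exact ⟨j, hj, hij.symm⟩
    · exact ⟨i, hi, hij⟩
    · exact ⟨i, hi, hik⟩
  choose! l hl hlpos using hint
  have hmem : ∀ a m, m ∈ τ → m ≠ a → m ∈ insert p (τ.erase a) := fun a m hm hma =>
    Finset.mem_insert_of_mem (Finset.mem_erase.2 ⟨hma, hm⟩)
  have hpne : ∀ m ∈ τ, p ≠ m := fun m hm e => hp (e ▸ hm)
  let P : α → ℝ := fun m => pw (A m) (f m)
  have hP : ∀ m ∈ τ, 0 < P m := h.pos
  -- The coordinate of the lift of `q a` at the vertex `m`, with respect to the lifts of `p` and of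
  -- the vertices of `τ`.
  let b : α → α → ℝ := fun a m => pw (A m) (f (q a)) / P m
  have hPb : ∀ a, ∀ m ∈ τ, P m * b a m = pw (A m) (f (q a)) := fun a m hm =>
    mul_div_cancel₀ _ (hP m hm).ne'
  have hbl : ∀ a ∈ ({i, j, k} : Set α), ∀ m ∈ τ, m ≠ a →
      b a m = l a m (f (q a)) + pw (A a) (f (q a)) * (P m)⁻¹ := by
    intro a ha m hm hma
    have h1 := h.pw_eq_add (hsub a ha) (hl a ha) hm hma (B := A m) (h.apex m hm)
      (fun v hv _ hvm => h.facet m hm v hv hvm) (f (q a))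
    have := (hP m hm).ne'
    simp only [b]
    rw [h1]
    change (_ + _ * P m) / P m = _
    field_simp
    ring
  have hbaa : ∀ a ∈ ({i, j, k} : Set α), b a a = pw (A a) (f (q a)) * (P a)⁻¹ := fun a _ =>
    div_eq_mul_inv _ _
  -- the spheres of the new simplices are in the pencils of those around `p`
  have hpencil : ∀ a ∈ ({i, j, k} : Set α), ∀ m ∈ τ, m ≠ a → ∃ θ, 0 < θ ∧ θ < 1 ∧
      ∀ y, pw (B a m) y = (1 - θ) * pw (A a) y + θ * pw (A m) y := by
    intro a ha m hm hma
    have haτ := hsub a ha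
    have hBp : pw (B a m) (f p) = 0 :=
      (hB a ha).facet m (hmem a m hm hma) p (Finset.mem_insert_self _ _) (hpne m hm)
    have hBv : ∀ v ∈ τ, v ≠ a → v ≠ m → pw (B a m) (f v) = 0 := fun v hv hva hvm =>
      (hB a ha).facet m (hmem a m hm hma) v (hmem a v hv hva) hvm
    have hBm : 0 < pw (B a m) (f m) := (hB a ha).pos m (hmem a m hm hma)
    have hy : ∀ y, pw (B a m) y
        = (1 - pw (B a m) (f m) / P m) * pw (A a) y + pw (B a m) (f m) / P m * pw (A m) y := by
      intro y
      have h1 := h.pw_eq_add haτ (hl a ha) hm hma hBp hBv y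
      have h2 := h.pw_eq_add haτ (hl a ha) hm hma (B := A m) (h.apex m hm)
        (fun v hv _ hvm => h.facet m hm v hv hvm) y
      have h3 := (hP m hm).ne'
      rw [h1, h2]
      change _ = _ + _ * (_ + _ * P m)
      field_simp
      ring
    refine ⟨_, div_pos hBm (hP m hm), ?_, hy⟩
    -- At `f a` the part from `A m` vanishes, and `f a` is outside the sphere of `B a m`; this gives
    -- `θ < 1`.
    have h4 := hy (f a)
    rw [h.facet m hm a haτ hma.symm, mul_zero, add_zero] at h4
    have h5 := hBa a ha m hm hma
    rw [h4] at h5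
    have h6 := (mul_pos_iff_of_pos_right (hP a haτ)).1 h5
    linarith
  -- `B a m` vanishes at the interior point `q a` and exceeds `A a` there by a positive multiple of
  -- `l a m`.
  have hneg : ∀ a ∈ ({i, j, k} : Set α), pw (A a) (f (q a)) < 0 := by
    intro a ha
    obtain ⟨m, hm, hma⟩ := hoth a ha
    have h1 := h.pw_eq_add (hsub a ha) (hl a ha) hm hma
      ((hB a ha).facet m (hmem a m hm hma) p (Finset.mem_insert_self _ _) (hpne m hm))
      (fun v hv hva hvm => (hB a ha).facet m (hmem a m hm hma) v (hmem a v hv hva) hvm) (f (q a))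
    rw [(hB a ha).apex m (hmem a m hm hma)] at h1
    have := mul_pos (hlpos a ha m (hmem a m hm hma)) ((hB a ha).pos m (hmem a m hm hma))
    linarith
  have hbpos : ∀ a ∈ ({i, j, k} : Set α), ∀ m ∈ τ, m ≠ a → 0 < b a m := by
    intro a ha m hm hma
    obtain ⟨θ, h0, h1, hy⟩ := hpencil a ha m hm hma
    have h2 := hy (f (q a))
    rw [(hB a ha).apex m (hmem a m hm hma)] at h2
    have h3 := hneg a ha
    refine div_pos ?_ (hP m hm)
    have h4 : 0 < θ * pw (A m) (f (q a)) := by nlinarith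
    exact (mul_pos_iff_of_pos_left h0).1 h4
  -- Eliminate `θ` between the vanishing of `B a a'` at `q a` and its positivity at `q a'`.
  have hone : ∀ a ∈ ({i, j, k} : Set α), ∀ a' ∈ ({i, j, k} : Set α), a ≠ a' →
      0 < pw (B a a') (f (q a')) → b a a * b a' a' < b a a' * b a' a := by
    intro a ha a' ha' hne hpos
    have haτ := hsub a ha
    have haτ' := hsub a' ha'
    obtain ⟨θ, h0, h1, hy⟩ := hpencil a ha a' haτ' hne.symm
    have h2 := hy (f (q a))
    rw [(hB a ha).apex a' (hmem a a' haτ' hne.symm), ← hPb a a haτ, ← hPb a a' haτ'] at h2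
    rw [hy (f (q a')), ← hPb a' a haτ, ← hPb a' a' haτ'] at hpos
    have h3 := mul_pos hpos (hbpos a ha a' haτ' hne.symm)
    have hX : 0 < (1 - θ) * P a := mul_pos (by linarith) (hP a haτ)
    have h4 : 0 < (1 - θ) * P a * (b a a' * b a' a - b a a * b a' a') := by
      linear_combination h3 - b a' a' * h2
    have := (mul_pos_iff_of_pos_left hX).1 h4
    linarith
  have hcs := h.sum_inv_smul hp hi (hl i (by simp))
  have hcm := h.sum_inv_mul hp hi (hl i (by simp))
  have hpe : ∀ a, p ∉ τ.erase a := fun a hh => hp (Finset.mem_of_mem_erase hh)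
  have hbsum : ∀ a ∈ ({i, j, k} : Set α),
      1 - ∑ m ∈ τ, b a m = l a p (f (q a)) - pw (A a) (f (q a)) * ∑ m ∈ τ, (P m)⁻¹ := by
    intro a ha
    have h1 := (hl a ha).sum_eq (f (q a))
    rw [Finset.sum_insert (hpe a)] at h1
    rw [← Finset.add_sum_erase _ _ (hsub a ha), ← Finset.add_sum_erase _ (fun m => (P m)⁻¹)
      (hsub a ha), hbaa a ha, Finset.sum_congr rfl fun m hm =>
      hbl a ha m (Finset.mem_of_mem_erase hm) (Finset.ne_of_mem_erase hm),
      Finset.sum_add_distrib, ← Finset.mul_sum]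
    linarith
  have hΛ : 0 < ∑ m ∈ τ, (P m)⁻¹ := Finset.sum_pos (fun m hm => inv_pos.2 (hP m hm)) ⟨i, hi⟩
  refine not_three_stacked (s := τ) (z := fun m => f m - f p) (c := fun m => (P m)⁻¹) (b := b)
    (y := fun a => f (q a) - f p) hi hj hk hij hik hjk ?_ ?_
    (fun m hm => inv_pos.2 (hP m hm)) hcs hbpos ?_ ?_ ?_ ?_ ?_
  · intro m hm h0
    have h1 := hP m hm
    simp only [P, sub_eq_zero.1 h0, h.apex m hm, lt_irrefl] at h1
  · intro m hm m' hm' he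
    by_contra hne
    have h1 := hP m hm
    simp only [sub_left_inj] at he
    simp only [P, he, h.facet m hm m' hm' (Ne.symm hne), lt_irrefl] at h1
  · intro a ha
    rw [← (hl a ha).sum_smul_sub hp, ← Finset.add_sum_erase _ _ (hsub a ha), hbaa a ha]
    rw [← Finset.add_sum_erase _ _ (hsub a ha)] at hcs
    have e : ∀ m ∈ τ.erase a, b a m • (f m - f p) = l a m (f (q a)) • (f m - f p)
        + pw (A a) (f (q a)) • ((P m)⁻¹ • (f m - f p)) := fun m hm => by
      rw [hbl a ha m (Finset.mem_of_mem_erase hm) (Finset.ne_of_mem_erase hm), add_smul, mul_smul]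
    rw [Finset.sum_congr rfl e, Finset.sum_add_distrib, ← Finset.smul_sum, mul_smul]
    rw [add_left_comm, ← smul_add, hcs, smul_zero, add_zero]
  · intro a ha
    have h1 := pw_eq_of_apex (h.apex a (hsub a ha)) (f (q a))
    set D := 2 • innerₗ E (f p) + (A a).linear with hD
    have h2 := congrArg D ((hl a ha).sum_smul_sub hp (f (q a)))
    simp only [map_sum, map_smul, smul_eq_mul] at h2
    have h3 : ∀ m ∈ τ.erase a, l a m (f (q a)) * D (f m - f p)
        = -(l a m (f (q a)) * ‖f m - f p‖ ^ 2) := fun m hm => by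
      have h4 := pw_eq_of_apex (h.apex a (hsub a ha)) (f m)
      rw [h.facet a (hsub a ha) m (Finset.mem_of_mem_erase hm) (Finset.ne_of_mem_erase hm)] at h4
      linear_combination (-l a m (f (q a))) * h4
    rw [Finset.sum_congr rfl h3, Finset.sum_neg_distrib] at h2
    rw [← Finset.add_sum_erase _ _ (hsub a ha)] at hcm
    rw [← Finset.add_sum_erase _ _ (hsub a ha), hbaa a ha]
    have e : ∀ m ∈ τ.erase a, b a m * ‖f m - f p‖ ^ 2 = l a m (f (q a)) * ‖f m - f p‖ ^ 2
        + pw (A a) (f (q a)) * ((P m)⁻¹ * ‖f m - f p‖ ^ 2) := fun m hm => by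
      rw [hbl a ha m (Finset.mem_of_mem_erase hm) (Finset.ne_of_mem_erase hm)]
      ring
    rw [Finset.sum_congr rfl e, Finset.sum_add_distrib, ← Finset.mul_sum]
    change (P a)⁻¹ * _ + ∑ m ∈ τ.erase a, (P m)⁻¹ * _ = 1 at hcm
    linear_combination pw (A a) (f (q a)) * hcm + h1 - h2
  · intro a ha
    rw [hbsum a ha]
    have h1 := hlpos a ha p (Finset.mem_insert_self _ _)
    have := mul_pos (neg_pos.2 (hneg a ha)) hΛ
    linarith
  · intro a ha
    -- The two sides differ by the coordinate of `q a` at `p`, divided by `P a`, which is positive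
    -- since `q a` is interior.
    rw [hbsum a ha, hbaa a ha]
    have h1 := hlpos a ha p (Finset.mem_insert_self _ _)
    have := mul_pos (inv_pos.2 (hP a (hsub a ha))) h1
    change -(_ * (P a)⁻¹) * _ ≤ (P a)⁻¹ * _
    nlinarith
  · intro a ha a' ha' hne
    rcases hpair a ha a' ha' hne with hh | hh
    · exact hone a ha a' ha' hne hh
    · have := hone a' ha' a ha hne.symm hh
      linarith

end IsStar

end Three

/-! ### Histories of stellar subdivisions -/

section History

lemma exists_suffix_of_mem {β : Type*} {h : List β} {t : β} (ht : t ∈ h) : ∃ g, (t :: g) <:+ h := by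
  obtain ⟨a, b, rfl⟩ := List.append_of_mem ht
  exact ⟨b, List.suffix_append _ _⟩

/-- Of two entries of a list, one comes after the other. -/
lemma suffix_cases {β : Type*} {h g g' : List β} {s t : β} (ht : (t :: g) <:+ h) (hs : (s :: g') <:+ h)
    (hne : s ≠ t) : (s :: g') <:+ g ∨ (t :: g) <:+ g' := by
  rcases List.suffix_or_suffix_of_suffix ht hs with h1 | h1
  · rcases List.suffix_cons_iff.1 h1 with h2 | h2
    · exact absurd (List.cons.inj h2).1.symm hne
    · exact Or.inr h2
  · rcases List.suffix_cons_iff.1 h1 with h2 | h2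
    · exact absurd (List.cons.inj h2).1 hne
    · exact Or.inl h2

variable {α : Type*} [DecidableEq α]

/-- The full-dimensional simplices after the stellar subdivisions in a list, the most recent one
first. -/
def tops (σ : Finset α) : List (Finset α × α) → Finset (Finset α)
  | [] => {σ}
  | t :: h => stack (tops σ h) t.1 t.2

/-- The vertices after the stellar subdivisions in a list. -/
def vset (σ : Finset α) : List (Finset α × α) → Finset α
  | [] => σ
  | t :: h => insert t.2 (vset σ h)

/-- Each subdivision takes place at an existing simplex and uses a new vertex. -/
def Valid (σ : Finset α) : List (Finset α × α) → Prop
  | [] => True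
  | t :: h => Valid σ h ∧ t.1 ∈ tops σ h ∧ t.2 ∉ vset σ h

variable {σ F : Finset α} {h g : List (Finset α × α)} {s t : Finset α × α}

lemma Valid.suffix (hV : Valid σ h) (hg : g <:+ h) : Valid σ g := by
  obtain ⟨k, rfl⟩ := hg
  induction k with
  | nil => exact hV
  | cons t k ih => exact ih hV.1

lemma vset_mono (hg : g <:+ h) : vset σ g ⊆ vset σ h := by
  obtain ⟨k, rfl⟩ := hg
  induction k with
  | nil => exact subset_rfl
  | cons t k ih => exact ih.trans (Finset.subset_insert _ _)

lemma mem_vset_of_mem (ht : t ∈ h) : t.2 ∈ vset σ h := by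
  induction h with
  | nil => simp at ht
  | cons t' h ih =>
    rcases List.mem_cons.1 ht with rfl | ht
    · exact Finset.mem_insert_self _ _
    · exact Finset.mem_insert_of_mem (ih ht)

lemma Valid.tops_subset (hV : Valid σ h) (hF : F ∈ tops σ h) : F ⊆ vset σ h := by
  induction h generalizing F with
  | nil => rw [tops, Finset.mem_singleton] at hF; exact hF.subset
  | cons t h ih =>
    rcases mem_stack.1 hF with ⟨-, hF⟩ | ⟨v, hv, rfl⟩
    · exact (ih hV.1 hF).trans (Finset.subset_insert _ _)
    · exact Finset.insert_subset_insert _ ((Finset.erase_subset _ _).trans (ih hV.1 hV.2.1))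

lemma Valid.notMem (hV : Valid σ (t :: h)) : t.2 ∉ t.1 :=
  fun hh => hV.2.2 (hV.1.tops_subset hV.2.1 hh)

lemma Valid.card_eq (hV : Valid σ h) (hF : F ∈ tops σ h) : F.card = σ.card := by
  induction h generalizing F with
  | nil => rw [tops, Finset.mem_singleton] at hF; rw [hF]
  | cons t h ih =>
    rcases mem_stack.1 hF with ⟨-, hF⟩ | ⟨v, hv, rfl⟩
    · exact ih hV.1 hF
    · have h1 := ih hV.1 hV.2.1
      rw [Finset.card_insert_of_notMem fun hh => hV.notMem (Finset.mem_of_mem_erase hh),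
        Finset.card_erase_of_mem hv, h1]
      have := Finset.card_pos.2 ⟨v, hv⟩
      omega

lemma Valid.verts_tops (hV : Valid σ h) (hc : 2 ≤ σ.card) : verts (tops σ h) = vset σ h := by
  induction h with
  | nil => simp [verts, tops, vset]
  | cons t h ih =>
    rw [tops, verts_stack hV.2.1 (by rw [hV.1.card_eq hV.2.1]; exact hc), ih hV.1, vset]

lemma Valid.fst_subset (hV : Valid σ h) (ht : t ∈ h) : t.1 ⊆ vset σ h := by
  obtain ⟨g, hg⟩ := exists_suffix_of_mem ht
  have := hV.suffix hg
  exact (this.1.tops_subset this.2.1).trans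
    ((vset_mono (List.suffix_cons _ _)).trans (vset_mono hg))

/-- A simplex with the new vertex of `s` is subdivided after `s`. -/
lemma Valid.suffix_of_mem {g g' : List (Finset α × α)} (hV : Valid σ h) (ht : (t :: g) <:+ h)
    (hs : (s :: g') <:+ h) (hst : s.2 ∈ t.1) : (s :: g') <:+ g := by
  have hVt := hV.suffix ht
  rcases suffix_cases ht hs (fun e => by subst e; exact hVt.notMem hst) with h1 | h1
  · exact h1
  · exact absurd ((hVt.1.tops_subset hVt.2.1).trans
      ((vset_mono (List.suffix_cons _ _)).trans (vset_mono h1)) hst) (hV.suffix hs).2.2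

lemma Valid.snd_injective (hV : Valid σ h) (ht : t ∈ h) (hs : s ∈ h) (he : s.2 = t.2) :
    s = t := by
  by_contra hne
  obtain ⟨g, hg⟩ := exists_suffix_of_mem ht
  obtain ⟨g', hg'⟩ := exists_suffix_of_mem hs
  rcases suffix_cases hg hg' hne with h1 | h1
  · exact (hV.suffix hg).2.2 (he ▸ vset_mono h1 (mem_vset_of_mem List.mem_cons_self))
  · exact (hV.suffix hg').2.2 (he ▸ vset_mono h1 (mem_vset_of_mem List.mem_cons_self))

/-- A subdivided simplex does not reappear. -/
lemma Valid.fst_notMem_tops (hV : Valid σ h) (ht : t ∈ h) : t.1 ∉ tops σ h := by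
  induction h with
  | nil => simp at ht
  | cons t' h ih =>
    intro hm
    rcases mem_stack.1 hm with ⟨hne, hm⟩ | ⟨v, hv, he⟩
    · rcases List.mem_cons.1 ht with rfl | ht
      · exact hne rfl
      · exact ih hV.1 ht hm
    · have h1 : t'.2 ∈ t.1 := he ▸ Finset.mem_insert_self _ _
      rcases List.mem_cons.1 ht with rfl | ht
      · exact hV.notMem h1
      · exact hV.2.2 (hV.1.fst_subset ht h1)

lemma Valid.fst_injective (hV : Valid σ h) (ht : t ∈ h) (hs : s ∈ h) (he : s.1 = t.1) :
    s = t := by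
  by_contra hne
  obtain ⟨g, hg⟩ := exists_suffix_of_mem ht
  obtain ⟨g', hg'⟩ := exists_suffix_of_mem hs
  rcases suffix_cases hg hg' hne with h1 | h1
  · exact (hV.suffix hg).1.fst_notMem_tops (h1.subset List.mem_cons_self)
      (he ▸ (hV.suffix hg).2.1)
  · exact (hV.suffix hg').1.fst_notMem_tops (h1.subset List.mem_cons_self)
      (he ▸ (hV.suffix hg').2.1)

lemma insert_erase_injOn {τ : Finset α} {p v w : α} (hp : p ∉ τ) (hv : v ∈ τ)
    (he : insert p (τ.erase v) = insert p (τ.erase w)) : v = w := by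
  by_contra hne
  have h1 : v ∈ insert p (τ.erase w) := Finset.mem_insert_of_mem (Finset.mem_erase.2 ⟨hne, hv⟩)
  rw [← he] at h1
  rcases Finset.mem_insert.1 h1 with rfl | h1
  · exact hp hv
  · exact Finset.notMem_erase _ _ h1

end History

/-! ### Necessity: at most two generated simplices are subdivided. -/

section Necessity

variable {α E : Type*} [DecidableEq α] [NormedAddCommGroup E] [InnerProductSpace ℝ E]
  {σ : Finset α} {h g : List (Finset α × α)} {s : Finset α × α} {f : α → E}

lemma IsDel.suffix (hV : Valid σ h) (hc : 2 ≤ σ.card) (hf : IsDel (tops σ h) f) (hg : g <:+ h) :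
    IsDel (tops σ g) f := by
  obtain ⟨k, rfl⟩ := hg
  induction k with
  | nil => exact hf
  | cons t k ih =>
    exact ih hV.1 (hf.of_stack hV.2.1 (by rw [hV.1.verts_tops hc]; exact hV.2.2)
      (by rw [hV.1.card_eq hV.2.1]; exact hc))

/-- In a Delaunay realization, at most two of the simplices generated by a single stellar
subdivision are further subdivided. -/
theorem IsDel.encard_le_two (hV : Valid σ h) (hc : 2 ≤ σ.card) (hf : IsDel (tops σ h) f)
    (hs : s ∈ h) :
    {F | (∃ v ∈ s.1, F = insert s.2 (s.1.erase v)) ∧ ∃ t ∈ h, t.1 = F}.encard ≤ 2 := by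
  by_contra hlt
  push Not at hlt
  obtain ⟨Y, hY, hY3⟩ := Set.exists_subset_encard_eq (Order.add_one_le_of_lt hlt)
  rw [show (2 : ℕ∞) + 1 = 3 by norm_num] at hY3
  obtain ⟨F1, F2, F3, h12, h13, h23, rfl⟩ := Set.encard_eq_three.1 hY3
  simp only [Set.insert_subset_iff, Set.singleton_subset_iff, Set.mem_ofPred_eq] at hY
  obtain ⟨⟨⟨i, hi, rfl⟩, ti, hti, hti'⟩, ⟨⟨j, hj, rfl⟩, tj, htj, htj'⟩,
    ⟨k, hk, rfl⟩, tk, htk, htk'⟩ := hY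
  have hij : i ≠ j := fun e => h12 (by rw [e])
  have hik : i ≠ k := fun e => h13 (by rw [e])
  have hjk : j ≠ k := fun e => h23 (by rw [e])
  obtain ⟨τ, p⟩ := s
  simp only at *
  obtain ⟨gs, hgs⟩ := exists_suffix_of_mem hs
  have hVs := hV.suffix hgs
  have hp : p ∉ τ := hVs.notMem
  have hcτ : 2 ≤ τ.card := by rw [hVs.1.card_eq hVs.2.1]; exact hc
  have hDs := hf.suffix hV hc hgs
  obtain ⟨A, hA, -⟩ := hDs.exists_star hp hcτ fun v hv => child_mem_stack hv
  have hsub : ∀ a ∈ ({i, j, k} : Set α), a ∈ τ := by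
    rintro a (rfl | rfl | rfl) <;> assumption
  have hex : ∀ a ∈ ({i, j, k} : Set α), ∃ q, (insert p (τ.erase a), q) ∈ h := by
    rintro a (rfl | rfl | rfl)
    exacts [⟨ti.2, hti' ▸ hti⟩, ⟨tj.2, htj' ▸ htj⟩, ⟨tk.2, htk' ▸ htk⟩]
  choose! q hq using hex
  have hex2 : ∀ a ∈ ({i, j, k} : Set α), ∃ g, ((insert p (τ.erase a), q a) :: g) <:+ h :=
    fun a ha => exists_suffix_of_mem (hq a ha)
  choose! g hg using hex2
  have hVg : ∀ a ∈ ({i, j, k} : Set α), Valid σ ((insert p (τ.erase a), q a) :: g a) :=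
    fun a ha => hV.suffix (hg a ha)
  have hDg : ∀ a ∈ ({i, j, k} : Set α),
      IsDel (stack (tops σ (g a)) (insert p (τ.erase a)) (q a)) f :=
    fun a ha => hf.suffix hV hc (hg a ha)
  have hcC : ∀ a ∈ ({i, j, k} : Set α), 2 ≤ (insert p (τ.erase a)).card := fun a ha => by
    rw [(hVg a ha).1.card_eq (hVg a ha).2.1]; exact hc
  have hsuf : ∀ a ∈ ({i, j, k} : Set α), ((τ, p) :: gs) <:+ g a := fun a ha =>
    hV.suffix_of_mem (hg a ha) hgs (Finset.mem_insert_self _ _)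
  have hτg : ∀ a ∈ ({i, j, k} : Set α), insert p τ ⊆ vset σ (g a) := fun a ha =>
    (Finset.insert_subset_insert _ (hVs.1.tops_subset hVs.2.1)).trans (vset_mono (hsuf a ha))
  have hqn : ∀ a ∈ ({i, j, k} : Set α), q a ∉ vset σ (g a) := fun a ha => (hVg a ha).2.2
  have hBex : ∀ a ∈ ({i, j, k} : Set α), ∃ B, IsStar (insert p (τ.erase a)) (q a) f B ∧
      ∀ v ∈ insert p (τ.erase a), IsEmptySphere (stack (tops σ (g a)) (insert p (τ.erase a)) (q a))
        f (insert (q a) ((insert p (τ.erase a)).erase v)) (B v) := fun a ha =>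
    (hDg a ha).exists_star (hVg a ha).notMem (hcC a ha) fun v hv => child_mem_stack hv
  choose! B hB hBe using hBex
  have hvg : ∀ a ∈ ({i, j, k} : Set α),
      verts (stack (tops σ (g a)) (insert p (τ.erase a)) (q a)) = insert (q a) (vset σ (g a)) :=
    fun a ha => (hVg a ha).verts_tops hc
  have hmem : ∀ a m, m ∈ τ → m ≠ a → m ∈ insert p (τ.erase a) := fun a m hm hma =>
    Finset.mem_insert_of_mem (Finset.mem_erase.2 ⟨hma, hm⟩)
  -- If the simplex opposite `a'` is subdivided before the one opposite `a`, then `q a'` is already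
  -- a vertex when the spheres `B a` are empty. One order suffices, as the conclusion drawn from it
  -- is symmetric.
  have hone : ∀ a ∈ ({i, j, k} : Set α), ∀ a' ∈ ({i, j, k} : Set α), a ≠ a' →
      ((insert p (τ.erase a'), q a') :: g a') <:+ g a → 0 < pw (B a a') (f (q a')) := by
    intro a ha a' ha' hne hsuff
    have h1 : q a' ∈ vset σ (g a) := vset_mono hsuff (Finset.mem_insert_self _ _)
    refine (hBe a ha a' (hmem a a' (hsub a' ha') hne.symm)).2 _
      (by rw [hvg a ha]; exact Finset.mem_insert_of_mem h1) fun hm => ?_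
    rcases Finset.mem_insert.1 hm with e | hm
    · exact hqn a ha (e ▸ h1)
    · have h2 := Finset.insert_subset_insert p (Finset.erase_subset a τ) (Finset.mem_of_mem_erase hm)
      exact hqn a' ha' (hτg a' ha' h2)
  refine hA.not_three hp hi hj hk hij hik hjk hB ?_ ?_ ?_
  · intro a ha m hm hma
    have h1 : a ∈ vset σ (g a) := hτg a ha (Finset.mem_insert_of_mem (hsub a ha))
    refine (hBe a ha m (hmem a m hm hma)).2 a
      (by rw [hvg a ha]; exact Finset.mem_insert_of_mem h1) fun hm' => ?_
    rcases Finset.mem_insert.1 hm' with e | hm'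
    · exact hqn a ha (e ▸ h1)
    · rcases Finset.mem_insert.1 (Finset.mem_of_mem_erase hm') with e | hm''
      · exact hp (e ▸ hsub a ha)
      · exact Finset.notMem_erase _ _ hm''
  · intro a ha
    have hpC : p ∈ insert p (τ.erase a) := Finset.mem_insert_self _ _
    obtain ⟨l, hl⟩ := (hDg a ha).bary _ (child_mem_stack hpC)
    exact (hB a ha).exists_bary (hVg a ha).notMem hpC hl
  · intro a ha a' ha' hne
    have hne' : (insert p (τ.erase a'), q a') ≠ (insert p (τ.erase a), q a) := fun e =>
      hne (insert_erase_injOn hp (hsub a ha) (Prod.mk.inj e).1.symm)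
    rcases suffix_cases (hg a ha) (hg a' ha') hne' with h1 | h1
    · exact Or.inl (hone a ha a' ha' hne h1)
    · exact Or.inr (hone a' ha' a ha hne.symm h1)

end Necessity

end StellarDelaunay

open Filter Topology

namespace StellarDelaunay

/-! ### Inserting a vertex near a given vertex -/

section Insert

variable {E : Type*} [NormedAddCommGroup E] [InnerProductSpace ℝ E]

/-- The variance in `pw_sum_smul` is positive: the vertex `p` has positive weight and differs from
`x`. -/
lemma IsBary.pw_neg {α : Type*} {F : Finset α} {p : α} {f : α → E}
    {l : α → E →ᵃ[ℝ] ℝ} {x : E} (hl : IsBary F f l) {A : E →ᵃ[ℝ] ℝ} (hA : ∀ v ∈ F, pw A (f v) = 0)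
    (hx : ∀ v ∈ F, 0 < l v x) (hp : p ∈ F) (hxp : f p ≠ x) : pw A x < 0 := by
  have h1 := pw_sum_smul A F (fun v => l v x) f (hl.sum_eq x)
  rw [hl.sum_smul x, Finset.sum_eq_zero fun v hv => by rw [hA v hv, mul_zero], zero_sub] at h1
  rw [h1, neg_lt_zero]
  refine Finset.sum_pos' (fun v hv => mul_nonneg (hx v hv).le (sq_nonneg _)) ⟨p, hp, ?_⟩
  have := norm_pos_iff.2 (sub_ne_zero.2 hxp)
  have := hx p hp
  positivity

lemma sum_smul_mem_convexHull {α : Type*} {F : Finset α} {f : α → E} {w : α → ℝ}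
    (h0 : ∀ v ∈ F, 0 ≤ w v) (h1 : ∑ v ∈ F, w v = 1) :
    ∑ v ∈ F, w v • f v ∈ convexHull ℝ (f '' F) :=
  (convex_convexHull ℝ _).sum_mem h0 h1 fun _ hv =>
    subset_convexHull ℝ _ (Set.mem_image_of_mem f hv)

variable {α : Type*} [DecidableEq α]
  {S : Finset (Finset α)} {F G : Finset α} {p q : α} {f : α → E} {l : α → E →ᵃ[ℝ] ℝ} {u x : E}

lemma eventually_pw_pos {A : E →ᵃ[ℝ] ℝ} {y : E} (h : 0 < pw A y) (u : E) :
    ∀ᶠ ε in 𝓝[>] (0 : ℝ), 0 < pw A (y + ε • u) := by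
  have hc : Continuous fun ε : ℝ => pw A (y + ε • u) := by
    simp only [pw_add_smul_vec]
    fun_prop
  have h0 : Tendsto (fun ε : ℝ => pw A (y + ε • u)) (𝓝[>] 0) (𝓝 (pw A y)) := by
    have := hc.tendsto 0
    simp only [zero_smul, add_zero] at this
    exact this.mono_left nhdsWithin_le_nhds
  exact h0.eventually (lt_mem_nhds h)

/-- The coordinate at `p` is close to 1; the others start at 0 with positive slope. -/
lemma IsBary.eventually_pos (hl : IsBary F f l) (hp : p ∈ F)
    (hu : ∀ v ∈ F, v ≠ p → 0 < (l v).linear u) :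
    ∀ᶠ ε in 𝓝[>] (0 : ℝ), ∀ v ∈ F, 0 < l v (f p + ε • u) := by
  rw [eventually_all_finset]
  intro v hv
  by_cases hvp : v = p
  · subst hvp
    have hc : Continuous fun ε : ℝ => l v (f v + ε • u) := by
      simp only [affineMap_add_smul]
      fun_prop
    have h0 : Tendsto (fun ε : ℝ => l v (f v + ε • u)) (𝓝[>] 0) (𝓝 1) := by
      have := hc.tendsto 0
      simp only [zero_smul, add_zero, hl.self v hv] at this
      exact this.mono_left nhdsWithin_le_nhds
    exact h0.eventually (lt_mem_nhds one_pos)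
  · filter_upwards [self_mem_nhdsWithin] with ε hε
    rw [affineMap_add_smul, hl.other v hv p hp hvp, zero_add]
    exact mul_pos hε (hu v hv hvp)

/-- Stellar subdivision of `F` by a point close to its vertex `f p`, in the direction `u`. -/
theorem IsDel.stack_near (h : IsDel S f) (hF : F ∈ S) {N : ℕ} (hcard : ∀ G ∈ S, G.card = N)
    (hN : 2 ≤ N) (hp : p ∈ F) (hq : q ∉ verts S) (hl : IsBary F f l)
    (hu : ∀ v ∈ F, v ≠ p → 0 < (l v).linear u)
    (hstar : ∀ G ∈ S, G ≠ F → p ∈ G → ∃ A, IsEmptySphere S f G A ∧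
      ∀ᶠ ε in 𝓝[>] (0 : ℝ), 0 < pw A (f p + ε • u))
    (hnb : ∀ w ∈ F, w ≠ p → ∃ G ∈ S, G ≠ F ∧ F.erase w ⊆ G) :
    ∀ᶠ ε in 𝓝[>] (0 : ℝ), (∀ v ∈ F, 0 < l v (f p + ε • u)) ∧
      IsDel (stack S F q) (Function.update f q (f p + ε • u)) := by
  obtain ⟨AF, hAF0, hAF⟩ := h.sphere F hF
  have hcF : 2 ≤ F.card := hcard F hF ▸ hN
  have hqF := notMem_of_notMem_verts hq hF
  have hall : ∀ G ∈ S.erase F, ∃ A, IsEmptySphere S f G A ∧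
      ∀ᶠ ε in 𝓝[>] (0 : ℝ), 0 < pw A (f p + ε • u) := by
    intro G hG
    obtain ⟨hGF, hG⟩ := Finset.mem_erase.1 hG
    by_cases hpG : p ∈ G
    · exact hstar G hG hGF hpG
    · obtain ⟨A, hA⟩ := h.sphere G hG
      exact ⟨A, hA, eventually_pw_pos (hA.2 p (mem_verts.2 ⟨F, hF, hp⟩) hpG) u⟩
  choose! A hA hAev using hall
  have E1 := hl.eventually_pos hp hu
  have E2 : ∀ᶠ ε in 𝓝[>] (0 : ℝ), ∀ G ∈ S.erase F, 0 < pw (A G) (f p + ε • u) :=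
    (eventually_all_finset _).2 hAev
  -- The power of `f w` for the sphere through the new point and the facet opposite `p`. It tends to
  -- the power for the circumsphere of `F`, as `pw AF (f p) = 0` and `l p (f p) = 1`.
  have E3 : ∀ᶠ ε in 𝓝[>] (0 : ℝ), ∀ w ∈ (verts S).filter (· ∉ F),
      0 < pw AF (f w) + -(pw AF (f p + ε • u)) / l p (f p + ε • u) * l p (f w) := by
    rw [eventually_all_finset]
    intro w hw
    obtain ⟨hw, hwF⟩ := Finset.mem_filter.1 hw
    have h1 : ContinuousAt (fun ε : ℝ => pw AF (f w)
        + -(pw AF (f p + ε • u)) / l p (f p + ε • u) * l p (f w)) 0 := by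
      have hc1 : Continuous fun ε : ℝ => pw AF (f p + ε • u) := by
        simp only [pw_add_smul_vec]; fun_prop
      have hc2 : Continuous fun ε : ℝ => l p (f p + ε • u) := by
        simp only [affineMap_add_smul]; fun_prop
      refine continuousAt_const.add (ContinuousAt.mul (hc1.continuousAt.neg.div hc2.continuousAt ?_)
        continuousAt_const)
      rw [zero_smul, add_zero, hl.self p hp]
      exact one_ne_zero
    have h0 : Tendsto (fun ε : ℝ => pw AF (f w)
        + -(pw AF (f p + ε • u)) / l p (f p + ε • u) * l p (f w)) (𝓝[>] 0) (𝓝 (pw AF (f w))) := by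
      have := h1.tendsto
      simp only [zero_smul, add_zero, hAF0 p hp, neg_zero, zero_div, zero_mul] at this
      exact this.mono_left nhdsWithin_le_nhds
    exact h0.eventually (lt_mem_nhds (hAF w hw hwF))
  filter_upwards [E1, E2, E3, self_mem_nhdsWithin] with ε e1 e2 e3 hε
  refine ⟨e1, ?_⟩
  set x := f p + ε • u with hx
  set f' := Function.update f q x with hf'
  have hf'q : f' q = x := Function.update_self _ _ _
  have hf'v : ∀ v ∈ verts S, f' v = f v := fun v hv =>
    Function.update_of_ne (fun e => hq (by rwa [← e])) _ _
  have hFv : ∀ G ∈ S, ∀ v ∈ G, v ∈ verts S := fun G hG v hv => mem_verts.2 ⟨G, hG, hv⟩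
  have hl' : IsBary F f' l := hl.congr fun v hv => (hf'v v (hFv F hF v hv)).symm
  have hvs := verts_stack (q := q) hF hcF
  have hxp : f p ≠ x := by
    intro he
    obtain ⟨v, hv, hvp⟩ := exists_ne_mem hcF p
    have := e1 v hv
    rw [← he, hl.other v hv p hp hvp] at this
    exact lt_irrefl _ this
  have hneg : pw AF x < 0 := hl.pw_neg hAF0 e1 hp hxp
  refine ⟨fun G hG => ?_, fun G hG => ?_⟩
  · rcases mem_stack.1 hG with ⟨-, hG⟩ | ⟨v, hv, rfl⟩
    · obtain ⟨l', hl'⟩ := h.bary G hG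
      exact ⟨l', hl'.congr fun v hv => (hf'v v (hFv G hG v hv)).symm⟩
    · have h1 : IsBary (insert v (F.erase v)) f' l := by rwa [Finset.insert_erase hv]
      exact ⟨_, h1.exchange (Finset.notMem_erase v F) (fun hh => hqF (Finset.mem_of_mem_erase hh))
        (by rw [hf'q]; exact (e1 v hv).ne')⟩
  · rcases mem_stack.1 hG with ⟨hGF, hG⟩ | ⟨v, hv, rfl⟩
    · have hGe : G ∈ S.erase F := Finset.mem_erase.2 ⟨hGF, hG⟩
      refine ⟨A G, fun v hv => ?_, fun w hw hwG => ?_⟩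
      · rw [hf'v v (hFv G hG v hv)]
        exact (hA G hGe).1 v hv
      · rw [hvs] at hw
        rcases Finset.mem_insert.1 hw with rfl | hw
        · rw [hf'q]
          exact e2 G hGe
        · rw [hf'v w hw]
          exact (hA G hGe).2 w hw hwG
    · by_cases hvp : v = p
      · subst hvp
        have hlv := e1 v hv
        refine ⟨AF + (-(pw AF x) / l v x) • l v, fun k hk => ?_, fun w hw hwG => ?_⟩
        · rw [pw_add_smul]
          rcases Finset.mem_insert.1 hk with rfl | hk
          · rw [hf'q, div_mul_cancel₀ _ hlv.ne', add_neg_cancel]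
          · obtain ⟨hkv, hkF⟩ := Finset.mem_erase.1 hk
            rw [hf'v k (hFv F hF k hkF), hAF0 k hkF, hl.other v hv k hkF hkv.symm, mul_zero,
              add_zero]
        · rw [pw_add_smul]
          rw [hvs] at hw
          have hwq : w ≠ q := fun e => hwG (e ▸ Finset.mem_insert_self _ _)
          have hw := (Finset.mem_insert.1 hw).resolve_left hwq
          rw [hf'v w hw]
          by_cases hwF : w ∈ F
          · have hwv : w = v := by
              by_contra hne
              exact hwG (Finset.mem_insert_of_mem (Finset.mem_erase.2 ⟨hne, hwF⟩))
            subst hwv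
            rw [hAF0 w hv, hl.self w hv, mul_one, zero_add]
            exact div_pos (neg_pos.2 hneg) hlv
          · exact e3 w (Finset.mem_filter.2 ⟨hw, hwF⟩)
      · obtain ⟨G, hGS, hGF, hsub⟩ := hnb v hv hvp
        have hGe : G ∈ S.erase F := Finset.mem_erase.2 ⟨hGF, hGS⟩
        have hGx := e2 G hGe
        -- The new simplex contains the facet common to `F` and `G`, so its sphere is in the pencil
        -- of theirs. Vanishing at `x` determines `θ`; it lies between 0 and 1 because `x` is inside
        -- the first sphere and outside the second.
        set θ := -(pw AF x) / (pw (A G) x - pw AF x) with hθ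
        have hd : 0 < pw (A G) x - pw AF x := by linarith
        have hθ0 : 0 < θ := div_pos (neg_pos.2 hneg) hd
        have hθ1 : 0 < 1 - θ := by
          rw [sub_pos, hθ, div_lt_one hd]
          linarith
        refine ⟨AF + θ • (A G - AF), fun k hk => ?_, fun w hw hwG => ?_⟩
        · rw [pw_combo]
          rcases Finset.mem_insert.1 hk with rfl | hk
          · rw [hf'q, hθ]
            field_simp
            ring
          · have hkF := Finset.mem_of_mem_erase hk
            rw [hf'v k (hFv F hF k hkF), hAF0 k hkF, (hA G hGe).1 k (hsub hk)]
            ring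
        · rw [pw_combo]
          rw [hvs] at hw
          have hwq : w ≠ q := fun e => hwG (e ▸ Finset.mem_insert_self _ _)
          have hw := (Finset.mem_insert.1 hw).resolve_left hwq
          rw [hf'v w hw]
          have hG0 : w ∉ G → 0 < pw (A G) (f w) := (hA G hGe).2 w hw
          have hG0' : 0 ≤ pw (A G) (f w) := by
            by_cases hm : w ∈ G
            · exact ((hA G hGe).1 w hm).ge
            · exact (hG0 hm).le
          by_cases hwF : w ∈ F
          · have hwv : w = v := by
              by_contra hne
              exact hwG (Finset.mem_insert_of_mem (Finset.mem_erase.2 ⟨hne, hwF⟩))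
            subst hwv
            rw [hAF0 w hv, mul_zero, zero_add]
            refine mul_pos hθ0 (hG0 fun hwG' => hGF ?_)
            have hFG : F ⊆ G := fun k hk => by
              by_cases hkw : k = w
              · exact hkw ▸ hwG'
              · exact hsub (Finset.mem_erase.2 ⟨hkw, hk⟩)
            exact (Finset.eq_of_subset_of_card_le hFG (by rw [hcard F hF, hcard G hGS])).symm
          · have := mul_pos hθ1 (hAF w hw hwF)
            have := mul_nonneg hθ0.le hG0'
            linarith

/-- The simplices of `S` cover the convex hull of the vertices. -/
def IsCov (S : Finset (Finset α)) (f : α → E) : Prop :=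
  ∀ y ∈ convexHull ℝ (f '' verts S), ∃ F ∈ S, y ∈ convexHull ℝ (f '' F)

lemma IsBary.nonneg_of_mem_convexHull (hl : IsBary F f l) {y : E}
    (hy : y ∈ convexHull ℝ (f '' F)) {v : α} (hv : v ∈ F) : 0 ≤ l v y := by
  have h1 : Convex ℝ {y | 0 ≤ l v y} := (convex_Ici (0 : ℝ)).affine_preimage (l v)
  refine convexHull_min ?_ h1 hy
  rintro _ ⟨w, hw, rfl⟩
  by_cases hvw : v = w
  · subst hvw
    exact zero_le_one.trans (hl.self v hv).ge
  · exact (hl.other v hv w hw hvw).ge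

/-- An interior point does not enlarge the convex hull, and the small simplices cover `F` by
`IsBary.exists_cover`. -/
lemma IsCov.stack (h : IsCov S f) (hF : F ∈ S) (hc : 2 ≤ F.card) (hq : q ∉ verts S)
    (hl : IsBary F f l) (hx : ∀ v ∈ F, 0 < l v x) :
    IsCov (stack S F q) (Function.update f q x) := by
  set f' := Function.update f q x with hf'
  have hf'q : f' q = x := Function.update_self _ _ _
  have hf'v : ∀ v ∈ verts S, f' v = f v := fun v hv =>
    Function.update_of_ne (fun e => hq (by rwa [← e])) _ _
  have hGS : ∀ G ∈ S, f' '' G = f '' G := fun G hG =>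
    Set.image_congr fun v hv => hf'v v (mem_verts.2 ⟨G, hG, hv⟩)
  have hqF := notMem_of_notMem_verts hq hF
  have hxF : x ∈ convexHull ℝ (f '' verts S) := by
    rw [← hl.sum_smul x]
    refine convexHull_mono (Set.image_mono ?_)
      (sum_smul_mem_convexHull (fun v hv => (hx v hv).le) (hl.sum_eq x))
    exact fun v hv => mem_verts.2 ⟨F, hF, hv⟩
  intro y hy
  have hy' : y ∈ convexHull ℝ (f '' verts S) := by
    refine convexHull_min ?_ (convex_convexHull ℝ _) hy
    rintro _ ⟨v, hv, rfl⟩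
    rw [verts_stack hF hc] at hv
    rcases Finset.mem_insert.1 hv with rfl | hv
    · rw [hf'q]; exact hxF
    · rw [hf'v v hv]
      exact subset_convexHull ℝ _ (Set.mem_image_of_mem f hv)
  obtain ⟨G, hG, hyG⟩ := h y hy'
  by_cases hGF : G = F
  · subst hGF
    have hl' : IsBary G f' l := hl.congr fun v hv => (hf'v v (mem_verts.2 ⟨G, hG, hv⟩)).symm
    obtain ⟨v, hv, w, hw0, hw1, rfl⟩ := hl'.exists_cover (Finset.card_pos.1 (by omega)) hqF
      (by rwa [hf'q]) fun v hv => hl.nonneg_of_mem_convexHull hyG hv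
    exact ⟨_, child_mem_stack hv, sum_smul_mem_convexHull hw0 hw1⟩
  · exact ⟨G, mem_stack.2 (Or.inl ⟨hGF, hG⟩), by rwa [hGS G hG]⟩

end Insert

/-! ### Subdividing two simplices around an interior vertex -/

section Direction

variable {E : Type*} [NormedAddCommGroup E] [InnerProductSpace ℝ E]

/-- The difference of the images of `z` and `y` under the inversion with centre `x`; it is tangent
at `x` to every sphere through `x`, `y` and `z`. -/
noncomputable def invDir (x y z : E) : E :=
  (‖z - x‖ ^ 2)⁻¹ • (z - x) - (‖y - x‖ ^ 2)⁻¹ • (y - x)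

variable {x y z u : E} {B : E →ᵃ[ℝ] ℝ}

lemma invDir_swap : invDir x z y = -invDir x y z := by
  simp [invDir]

/-- The contributions of `y` and `z` to the slope at `x` are explicit since `y` is on the sphere.
The slope has the sign of the power of `z`: the line is tangent if `z` is on the sphere and starts
outwards if `z` is outside. -/
lemma pw_invDir (hx : pw B x = 0) (hy : pw B y = 0) (hyx : y ≠ x) (hzx : z ≠ x) (t : ℝ) :
    pw B (x + t • invDir x y z)
      = t ^ 2 * ‖invDir x y z‖ ^ 2 + t * ((‖z - x‖ ^ 2)⁻¹ * pw B z) := by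
  rw [pw_eq_of_apex hx z, pw_eq_of_apex hx]
  have h1 := pw_eq_of_apex hx y
  set D := 2 • innerₗ E x + B.linear with hD
  have hy' : ‖y - x‖ ^ 2 ≠ 0 := pow_ne_zero 2 (norm_ne_zero_iff.2 (sub_ne_zero.2 hyx))
  have hz' : ‖z - x‖ ^ 2 ≠ 0 := pow_ne_zero 2 (norm_ne_zero_iff.2 (sub_ne_zero.2 hzx))
  have hDy : D (y - x) = -‖y - x‖ ^ 2 := by linarith
  rw [add_sub_cancel_left, norm_smul, mul_pow, Real.norm_eq_abs, sq_abs, map_smul, smul_eq_mul]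
  congr 2
  rw [invDir, map_sub, map_smul, map_smul, hDy]
  simp only [smul_eq_mul]
  linear_combination inv_mul_cancel₀ hy' - inv_mul_cancel₀ hz'

lemma invDir_ne_zero (hx : pw B x = 0) (hy : pw B y = 0) (hyx : y ≠ x) (hz : 0 < pw B z) :
    invDir x y z ≠ 0 := by
  have hzx : z ≠ x := fun e => by rw [e, hx] at hz; exact lt_irrefl _ hz
  intro h0
  have h1 := pw_invDir hx hy hyx hzx 1
  rw [h0] at h1
  simp only [smul_zero, add_zero, hx, norm_zero] at h1
  have h2 := norm_pos_iff.2 (sub_ne_zero.2 hzx)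
  have : 0 < (‖z - x‖ ^ 2)⁻¹ * pw B z := by positivity
  linarith

lemma pw_pos_invDir (hx : pw B x = 0) (hy : pw B y = 0) (hyx : y ≠ x) (hzx : z ≠ x)
    (hz : 0 ≤ pw B z) (h0 : invDir x y z ≠ 0) {t : ℝ} (ht : 0 < t) :
    0 < pw B (x + t • invDir x y z) := by
  rw [pw_invDir hx hy hyx hzx]
  have h1 := norm_pos_iff.2 h0
  have h2 := norm_pos_iff.2 (sub_ne_zero.2 hzx)
  have h3 : 0 ≤ t * ((‖z - x‖ ^ 2)⁻¹ * pw B z) := by positivity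
  have h4 : 0 < t ^ 2 * ‖invDir x y z‖ ^ 2 := by positivity
  linarith

/-- If `x` lies between two points of a line and on a sphere through the first then the second
one is outside. -/
lemma pw_pos_of_opposite (hx : pw B x = 0) (h0 : u ≠ 0) {s t : ℝ} (hs : 0 < s)
    (hsu : pw B (x + s • u) = 0) (ht : 0 < t) : 0 < pw B (x + t • -u) := by
  rw [pw_eq_of_apex hx] at hsu ⊢
  set D := 2 • innerₗ E x + B.linear with hD
  simp only [add_sub_cancel_left, norm_smul, mul_pow, Real.norm_eq_abs, sq_abs, map_smul,
    smul_eq_mul, norm_neg, map_neg] at hsu ⊢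
  have h1 := norm_pos_iff.2 h0
  have h2 : D u = -(s * ‖u‖ ^ 2) := by
    have : s * (s * ‖u‖ ^ 2 + D u) = 0 := by linarith
    linarith [(mul_eq_zero.1 this).resolve_left hs.ne']
  rw [h2]
  have : 0 < t ^ 2 * ‖u‖ ^ 2 := by positivity
  have : 0 < t * (s * ‖u‖ ^ 2) := by positivity
  linarith

lemma IsStar.ne_apex {α : Type*} {τ : Finset α} {p : α} {f : α → E} {A : α → E →ᵃ[ℝ] ℝ}
    (h : IsStar τ p f A) {v : α} (hv : v ∈ τ) :
    f v ≠ f p := fun e => by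
  have := h.pos v hv
  rw [e, h.apex v hv] at this
  exact lt_irrefl _ this

lemma IsStar.invDir_ne_zero {α : Type*} {τ : Finset α} {p a b : α} {f : α → E}
    {A : α → E →ᵃ[ℝ] ℝ} (h : IsStar τ p f A) (ha : a ∈ τ) (hb : b ∈ τ) (hab : a ≠ b) :
    invDir (f p) (f a) (f b) ≠ 0 :=
  StellarDelaunay.invDir_ne_zero (h.apex b hb) (h.facet b hb a ha hab) (h.ne_apex ha) (h.pos b hb)

end Direction

/-! ### Inserting one or two points next to an interior vertex. -/

section Pair

variable {α E : Type*} [DecidableEq α] [NormedAddCommGroup E] [InnerProductSpace ℝ E]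
  {S : Finset (Finset α)} {τ : Finset α} {p a b qa qb : α} {f : α → E}
  {A : α → E →ᵃ[ℝ] ℝ} {l : α → E →ᵃ[ℝ] ℝ}

namespace IsStar

/-- The coordinate `l v` is 0 at `f p`, negative at `f a` and 0 or 1 at `f b`. Hence the direction
points from `f p` into the simplex opposite `a`. -/
lemma linear_invDir_pos (h : IsStar τ p f A) (ha : a ∈ τ) (hb : b ∈ τ) (hab : a ≠ b)
    (hl : IsBary (insert p (τ.erase a)) f l) :
    ∀ v ∈ insert p (τ.erase a), v ≠ p → 0 < (l v).linear (invDir (f p) (f a) (f b)) := by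
  intro v hv hvp
  have hve := Finset.mem_erase.1 ((Finset.mem_insert.1 hv).resolve_left hvp)
  have hlp : l v (f p) = 0 := hl.other v hv p (Finset.mem_insert_self _ _) hvp
  have hlin : ∀ y, (l v).linear (y - f p) = l v y := fun y => by
    have := (l v).linearMap_vsub y (f p)
    rw [vsub_eq_sub, vsub_eq_sub, hlp, sub_zero] at this
    exact this
  rw [invDir, map_sub, map_smul, map_smul, hlin, hlin, smul_eq_mul, smul_eq_mul]
  have h1 := h.coord_neg ha hl hve.2 hve.1
  have h2 : 0 ≤ l v (f b) := by
    by_cases hvb : v = b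
    · subst hvb
      rw [hl.self v hv]
      exact zero_le_one
    · exact (hl.other v hv b (Finset.mem_insert_of_mem (Finset.mem_erase.2 ⟨hab.symm, hb⟩)) hvb).ge
  have h3 := norm_pos_iff.2 (sub_ne_zero.2 (h.ne_apex ha))
  have h4 : (‖f a - f p‖ ^ 2)⁻¹ * l v (f a) < 0 := mul_neg_of_pos_of_neg (by positivity) h1
  have h5 : 0 ≤ (‖f b - f p‖ ^ 2)⁻¹ * l v (f b) := by positivity
  linarith

end IsStar

lemma insert_erase_mem {v m : α} (hm : m ∈ τ) (hmv : m ≠ v) : m ∈ insert p (τ.erase v) :=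
  Finset.mem_insert_of_mem (Finset.mem_erase.2 ⟨hmv, hm⟩)

lemma erase_subset_child {v w : α} : (insert p (τ.erase v)).erase w ⊆ insert p (τ.erase w) := by
  intro k hk
  obtain ⟨hkw, hk⟩ := Finset.mem_erase.1 hk
  rcases Finset.mem_insert.1 hk with rfl | hk
  · exact Finset.mem_insert_self _ _
  · exact insert_erase_mem (Finset.mem_of_mem_erase hk) hkw

section Star

variable (h : IsDel S f) (hcov : IsCov S f) {N : ℕ} (hcard : ∀ G ∈ S, G.card = N) (hN : 2 ≤ N)
  (hp : p ∉ τ) (hc : 2 ≤ τ.card) (hS : ∀ v ∈ τ, insert p (τ.erase v) ∈ S)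
  (hpS : ∀ G ∈ S, p ∈ G → ∃ v ∈ τ, G = insert p (τ.erase v))
  (ha : a ∈ τ) (hb : b ∈ τ) (hab : a ≠ b) (hqa : qa ∉ verts S)

include h hcov hcard hN hp hc hS hpS ha hb hab hqa in
/-- One of the simplices around an interior vertex can be subdivided. -/
theorem eventually_stack_one : ∀ᶠ ε in 𝓝[>] (0 : ℝ),
    IsDel (stack S (insert p (τ.erase a)) qa)
        (Function.update f qa (f p + ε • invDir (f p) (f a) (f b))) ∧
      IsCov (stack S (insert p (τ.erase a)) qa)
        (Function.update f qa (f p + ε • invDir (f p) (f a) (f b))) := by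
  obtain ⟨A, hA, hAe⟩ := h.exists_star hp hc hS
  obtain ⟨l, hl⟩ := h.bary _ (hS a ha)
  have key := h.stack_near (hS a ha) hcard hN (Finset.mem_insert_self _ _) hqa hl
    (hA.linear_invDir_pos ha hb hab hl) ?_ ?_
  · filter_upwards [key] with ε hε
    exact ⟨hε.2, hcov.stack (hS a ha) (by rw [hcard _ (hS a ha)]; exact hN) hqa hl hε.1⟩
  · intro G hG hGa hpG
    obtain ⟨m, hm, rfl⟩ := hpS G hG hpG
    have hma : m ≠ a := fun e => hGa (by rw [e])
    -- The sphere opposite `m` passes through `f a`; `f b` is on it too, or outside if `m = b`. In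
    -- both cases the direction leaves the ball.
    refine ⟨A m, hAe m hm, ?_⟩
    filter_upwards [self_mem_nhdsWithin] with ε hε
    refine pw_pos_invDir (hA.apex m hm) (hA.facet m hm a ha hma.symm) (hA.ne_apex ha)
      (hA.ne_apex hb) ?_ (hA.invDir_ne_zero ha hb hab) hε
    by_cases hmb : b = m
    · subst hmb
      exact (hA.pos b hb).le
    · exact (hA.facet m hm b hb hmb).ge
  · intro w hw hwp
    have hwe := Finset.mem_erase.1 ((Finset.mem_insert.1 hw).resolve_left hwp)
    exact ⟨_, hS w hwe.2, fun e => hwe.1 (insert_erase_injOn hp hwe.2 e), erase_subset_child⟩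

end Star

/-- One of the simplices around an interior vertex can be subdivided. -/
theorem IsDel.exists_stack_one (h : IsDel S f) (hcov : IsCov S f) {N : ℕ}
    (hcard : ∀ G ∈ S, G.card = N) (hN : 2 ≤ N) (hp : p ∉ τ) (hc : 2 ≤ τ.card)
    (hS : ∀ v ∈ τ, insert p (τ.erase v) ∈ S)
    (hpS : ∀ G ∈ S, p ∈ G → ∃ v ∈ τ, G = insert p (τ.erase v))
    (ha : a ∈ τ) (hqa : qa ∉ verts S) :
    ∃ f' : α → E, IsDel (stack S (insert p (τ.erase a)) qa) f' ∧
      IsCov (stack S (insert p (τ.erase a)) qa) f' := by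
  obtain ⟨b, hb, hba⟩ := exists_ne_mem hc a
  obtain ⟨ε, hε⟩ := (eventually_stack_one h hcov hcard hN hp hc hS hpS ha hb hba.symm hqa).exists
  exact ⟨_, hε⟩

/-- Two of the simplices around an interior vertex can be subdivided: choose the new vertices on
opposite sides of it, on a common tangent line of all other circumspheres. -/
theorem IsDel.exists_stack_two (h : IsDel S f) (hcov : IsCov S f) {N : ℕ}
    (hcard : ∀ G ∈ S, G.card = N) (hN : 2 ≤ N) (hp : p ∉ τ) (hc : 2 ≤ τ.card)
    (hS : ∀ v ∈ τ, insert p (τ.erase v) ∈ S)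
    (hpS : ∀ G ∈ S, p ∈ G → ∃ v ∈ τ, G = insert p (τ.erase v))
    (ha : a ∈ τ) (hb : b ∈ τ) (hab : a ≠ b) (hqa : qa ∉ verts S) (hqb : qb ∉ verts S)
    (hq : qb ≠ qa) :
    ∃ f' : α → E, IsDel (stack (stack S (insert p (τ.erase a)) qa) (insert p (τ.erase b)) qb) f' ∧
      IsCov (stack (stack S (insert p (τ.erase a)) qa) (insert p (τ.erase b)) qb) f' := by
  obtain ⟨A, hA, hAe⟩ := h.exists_star hp hc hS
  obtain ⟨l, hl⟩ := h.bary _ (hS b hb)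
  obtain ⟨ε, ⟨h1, hcov1⟩, hε⟩ :=
    ((eventually_stack_one h hcov hcard hN hp hc hS hpS ha hb hab hqa).and
      self_mem_nhdsWithin).exists
  set u := invDir (f p) (f a) (f b) with hu
  have hu0 : u ≠ 0 := hA.invDir_ne_zero ha hb hab
  set f1 := Function.update f qa (f p + ε • u) with hf1
  set S1 := stack S (insert p (τ.erase a)) qa with hS1
  have hcC : 2 ≤ (insert p (τ.erase a)).card := by rw [hcard _ (hS a ha)]; exact hN
  have hne : insert p (τ.erase b) ≠ insert p (τ.erase a) := fun e =>
    hab.symm (insert_erase_injOn hp hb e)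
  have hbS1 : insert p (τ.erase b) ∈ S1 := mem_stack.2 (Or.inl ⟨hne, hS b hb⟩)
  have hcard1 : ∀ G ∈ S1, G.card = N := by
    intro G hG
    rcases mem_stack.1 hG with ⟨-, hG⟩ | ⟨v, hv, rfl⟩
    · exact hcard G hG
    · rw [Finset.card_insert_of_notMem fun hh =>
        notMem_of_notMem_verts hqa (hS a ha) (Finset.mem_of_mem_erase hh),
        Finset.card_erase_of_mem hv, hcard _ (hS a ha)]
      omega
  have hf1v : ∀ v ∈ verts S, f1 v = f v := fun v hv =>
    Function.update_of_ne (fun e => hqa (by rwa [← e])) _ _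
  have hf1q : f1 qa = f p + ε • u := Function.update_self _ _ _
  have hpV : p ∈ verts S := mem_verts.2 ⟨_, hS a ha, Finset.mem_insert_self _ _⟩
  have haV : a ∈ verts S := mem_verts.2 ⟨_, hS b hb, insert_erase_mem ha hab⟩
  have hbV : b ∈ verts S := mem_verts.2 ⟨_, hS a ha, insert_erase_mem hb hab.symm⟩
  have hl1 : IsBary (insert p (τ.erase b)) f1 l :=
    hl.congr fun v hv => (hf1v v (mem_verts.2 ⟨_, hS b hb, hv⟩)).symm
  have hqb1 : qb ∉ verts S1 := by
    rw [hS1, verts_stack (hS a ha) hcC, Finset.mem_insert]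
    rintro (e | e)
    · exact hq e
    · exact hqb e
  have hswap : invDir (f p) (f b) (f a) = -u := invDir_swap
  have key := h1.stack_near hbS1 hcard1 hN (Finset.mem_insert_self _ _) hqb1 hl1 (u := -u)
    (hswap ▸ hA.linear_invDir_pos hb ha hab.symm hl) ?_ ?_
  · obtain ⟨δ, hδ⟩ := key.exists
    exact ⟨_, hδ.2, hcov1.stack hbS1 (by rw [hcard1 _ hbS1]; exact hN) hqb1 hl1 hδ.1⟩
  · intro G hG hGb hpG
    obtain ⟨B, hB⟩ := h1.sphere G hG
    refine ⟨B, hB, ?_⟩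
    have hBp : pw B (f p) = 0 := hf1v p hpV ▸ hB.1 p hpG
    filter_upwards [self_mem_nhdsWithin] with δ hδ
    rw [hf1v p hpV]
    rcases mem_stack.1 hG with ⟨hGa, hGS⟩ | ⟨v, hv, rfl⟩
    · obtain ⟨m, hm, rfl⟩ := hpS G hGS hpG
      have hma : m ≠ a := fun e => hGa (by rw [e])
      have hmb : m ≠ b := fun e => hGb (by rw [e])
      rw [← hswap]
      refine pw_pos_invDir hBp ?_ (hA.ne_apex hb) (hA.ne_apex ha) ?_
        (hA.invDir_ne_zero hb ha hab.symm) hδ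
      · rw [← hf1v b hbV]
        exact hB.1 b (insert_erase_mem hb hmb.symm)
      · rw [← hf1v a haV]
        exact (hB.1 a (insert_erase_mem ha hma.symm)).ge
    -- A simplex created by the first insertion that contains `p` has `f p` and `f p + ε • u` on its
    -- sphere, so the opposite ray stays outside.
    · have hBq := hB.1 qa (Finset.mem_insert_self _ _)
      rw [hf1q] at hBq
      exact pw_pos_of_opposite hBp hu0 hε hBq hδ
  · intro w hw hwp
    have hwe := Finset.mem_erase.1 ((Finset.mem_insert.1 hw).resolve_left hwp)
    -- The former neighbour across the facet opposite `a` has been subdivided; its part omitting `b`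
    -- takes its place.
    by_cases hwa : w = a
    · subst hwa
      refine ⟨_, child_mem_stack (insert_erase_mem hb hab.symm), fun e => ?_, ?_⟩
      · exact notMem_of_notMem_verts hqa (hS b hb) (e ▸ Finset.mem_insert_self _ _)
      · intro k hk
        refine Finset.mem_insert_of_mem (Finset.mem_erase.2 ⟨?_, erase_subset_child hk⟩)
        rintro rfl
        rcases Finset.mem_insert.1 (Finset.mem_of_mem_erase hk) with e | hk'
        · exact hp (e ▸ hb)
        · exact Finset.notMem_erase _ _ hk'
    · exact ⟨_, mem_stack.2 (Or.inl ⟨fun e => hwa (insert_erase_injOn hp hwe.2 e), hS w hwe.2⟩),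
        fun e => hwe.1 (insert_erase_injOn hp hwe.2 e), erase_subset_child⟩

end Pair

/-! ### Construction of a Delaunay realization -/

section Lookahead

variable {α : Type*} [DecidableEq α]

open Classical in
/-- The simplices that replace `F` once it is subdivided, if this happens in the history `H`. -/
noncomputable def subdiv (H : List (Finset α × α)) (F : Finset α) : Finset (Finset α) :=
  if h : ∃ q, (F, q) ∈ H then F.image fun v => insert h.choose (F.erase v) else {F}

/-- Subdivide all simplices of `S` that are subdivided in the history `H`. -/
noncomputable def lookahead (H : List (Finset α × α)) (S : Finset (Finset α)) :
    Finset (Finset α) :=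
  S.biUnion (subdiv H)

variable {H g : List (Finset α × α)} {σ τ F G : Finset α} {p q a b : α} {S : Finset (Finset α)}

lemma subdiv_of_mem (hV : Valid σ H) (hF : (F, q) ∈ H) :
    subdiv H F = F.image fun v => insert q (F.erase v) := by
  have h : ∃ q, (F, q) ∈ H := ⟨q, hF⟩
  have hq : h.choose = q := (Prod.mk.inj (hV.fst_injective hF h.choose_spec rfl)).2
  rw [subdiv, dif_pos h, hq]

lemma subdiv_of_notMem (hF : ∀ q, (F, q) ∉ H) : subdiv H F = {F} := by
  rw [subdiv, dif_neg (not_exists.2 hF)]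

lemma mem_lookahead : G ∈ lookahead H S ↔ ∃ F ∈ S, G ∈ subdiv H F := by
  simp [lookahead]

lemma mem_subdiv (hV : Valid σ H) : G ∈ subdiv H F ↔
    ((∀ q, (F, q) ∉ H) ∧ G = F) ∨ ∃ q, (F, q) ∈ H ∧ ∃ v ∈ F, insert q (F.erase v) = G := by
  by_cases h : ∃ q, (F, q) ∈ H
  · obtain ⟨q, hq⟩ := h
    rw [subdiv_of_mem hV hq, Finset.mem_image]
    constructor
    · exact fun hG => Or.inr ⟨q, hq, hG⟩
    · rintro (⟨h1, -⟩ | ⟨q', hq', hG⟩)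
      · exact absurd hq (h1 q)
      · obtain rfl : q' = q := (Prod.mk.inj (hV.fst_injective hq hq' rfl)).2
        exact hG
  · push Not at h
    rw [subdiv_of_notMem h, Finset.mem_singleton]
    constructor
    · exact fun hG => Or.inl ⟨h, hG⟩
    · rintro (⟨-, hG⟩ | ⟨q, hq, -⟩)
      · exact hG
      · exact absurd hq (h q)

/-- Looking ahead changes nothing at the end of the history, since a subdivided simplex never
reappears. -/
lemma lookahead_tops (hV : Valid σ H) : lookahead H (tops σ H) = tops σ H := by
  ext G
  rw [mem_lookahead]
  have h : ∀ F ∈ tops σ H, subdiv H F = {F} := fun F hF =>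
    subdiv_of_notMem fun q hq => hV.fst_notMem_tops hq hF
  constructor
  · rintro ⟨F, hF, hG⟩
    rw [h F hF, Finset.mem_singleton] at hG
    exact hG ▸ hF
  · exact fun hG => ⟨G, hG, by rw [h G hG, Finset.mem_singleton]⟩

section Step

variable (hV : Valid σ H) (hg : ((τ, p) :: g) <:+ H)

include hV hg

/-- Before the step at `τ` is taken, looking ahead has already inserted `p`. Together with
`notMem_of_mem_lookahead_erase`, this identifies the star of `p` as that of a single stellar
subdivision. -/
lemma mem_lookahead_iff : G ∈ lookahead H (tops σ g) ↔
    G ∈ lookahead H ((tops σ g).erase τ) ∨ ∃ v ∈ τ, insert p (τ.erase v) = G := by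
  have hτ : (τ, p) ∈ H := hg.subset List.mem_cons_self
  have hτg : τ ∈ tops σ g := (hV.suffix hg).2.1
  rw [← Finset.mem_image, ← subdiv_of_mem hV hτ, mem_lookahead, mem_lookahead]
  constructor
  · rintro ⟨F, hF, hG⟩
    by_cases hFτ : F = τ
    · exact Or.inr (hFτ ▸ hG)
    · exact Or.inl ⟨F, Finset.mem_erase.2 ⟨hFτ, hF⟩, hG⟩
  · rintro (⟨F, hF, hG⟩ | hG)
    · exact ⟨F, Finset.mem_of_mem_erase hF, hG⟩
    · exact ⟨τ, hτg, hG⟩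

omit hV hg in
lemma mem_lookahead_cons_iff : G ∈ lookahead H (tops σ ((τ, p) :: g)) ↔
    G ∈ lookahead H ((tops σ g).erase τ) ∨ ∃ v ∈ τ, G ∈ subdiv H (insert p (τ.erase v)) := by
  rw [mem_lookahead, mem_lookahead]
  simp only [tops, stack, Finset.mem_union, Finset.mem_image]
  constructor
  · rintro ⟨F, hF | ⟨v, hv, rfl⟩, hG⟩
    · exact Or.inl ⟨F, hF, hG⟩
    · exact Or.inr ⟨v, hv, hG⟩
  · rintro (⟨F, hF, hG⟩ | ⟨v, hv, hG⟩)
    · exact ⟨F, Or.inl hF, hG⟩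
    · exact ⟨_, Or.inr ⟨v, hv, rfl⟩, hG⟩

lemma notMem_of_mem_lookahead_erase (hG : G ∈ lookahead H ((tops σ g).erase τ)) : p ∉ G := by
  have hVs := hV.suffix hg
  obtain ⟨F, hF, hGF⟩ := mem_lookahead.1 hG
  obtain ⟨hFτ, hF⟩ := Finset.mem_erase.1 hF
  have hpF : p ∉ F := fun h => hVs.2.2 (hVs.1.tops_subset hF h)
  rcases (mem_subdiv hV).1 hGF with ⟨-, rfl⟩ | ⟨q, hq, v, hv, rfl⟩
  · exact hpF
  · intro h
    rcases Finset.mem_insert.1 h with rfl | h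
    · exact hFτ (Prod.mk.inj (hV.snd_injective (hg.subset List.mem_cons_self) hq rfl)).1
    · exact hpF (Finset.mem_of_mem_erase h)

/-- The simplex subdivided by `q` contains `p`, so `q` comes after `p`. Looking ahead from `g` does
not insert `q` either: it serves only this one simplex, which is not yet present. -/
lemma notMem_verts_lookahead (hq : (insert p (τ.erase a), q) ∈ H) :
    q ∉ verts (lookahead H (tops σ g)) := by
  have hVs := hV.suffix hg
  obtain ⟨g', hg'⟩ := exists_suffix_of_mem hq
  have hsuf := hV.suffix_of_mem hg' hg (Finset.mem_insert_self _ _)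
  have hqg : q ∉ vset σ g := fun h => (hV.suffix hg').2.2
    (vset_mono hsuf (vset_mono (List.suffix_cons _ _) h))
  intro h
  obtain ⟨G, hG, hqG⟩ := mem_verts.1 h
  obtain ⟨F, hF, hGF⟩ := mem_lookahead.1 hG
  have hFg := hVs.1.tops_subset hF
  rcases (mem_subdiv hV).1 hGF with ⟨-, rfl⟩ | ⟨q', hq', v, hv, rfl⟩
  · exact hqg (hFg hqG)
  · rcases Finset.mem_insert.1 hqG with rfl | hqG
    · have := (Prod.mk.inj (hV.snd_injective hq' hq rfl)).1
      exact hVs.2.2 (hFg (this ▸ Finset.mem_insert_self _ _))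
    · exact hqg (hFg (Finset.mem_of_mem_erase hqG))

omit hg in
lemma card_of_mem_lookahead (hgH : g <:+ H) (hG : G ∈ lookahead H (tops σ g)) :
    G.card = σ.card := by
  obtain ⟨F, hF, hGF⟩ := mem_lookahead.1 hG
  have hFc := (hV.suffix hgH).card_eq hF
  rcases (mem_subdiv hV).1 hGF with ⟨-, rfl⟩ | ⟨q, hq, v, hv, rfl⟩
  · exact hFc
  · obtain ⟨g', hg'⟩ := exists_suffix_of_mem hq
    rw [Finset.card_insert_of_notMem fun h => (hV.suffix hg').notMem (Finset.mem_of_mem_erase h),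
      Finset.card_erase_of_mem hv, hFc]
    have := Finset.card_pos.2 ⟨v, hv⟩
    omega

lemma lookahead_cons_eq_zero (h0 : ∀ v ∈ τ, ∀ q, (insert p (τ.erase v), q) ∉ H) :
    lookahead H (tops σ ((τ, p) :: g)) = lookahead H (tops σ g) := by
  ext G
  rw [mem_lookahead_iff hV hg, mem_lookahead_cons_iff]
  refine or_congr Iff.rfl (exists_congr fun v => and_congr_right fun hv => ?_)
  rw [subdiv_of_notMem (h0 v hv), Finset.mem_singleton, eq_comm]

lemma lookahead_cons_eq_one (ha : a ∈ τ) (hq : (insert p (τ.erase a), q) ∈ H)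
    (h0 : ∀ v ∈ τ, v ≠ a → ∀ q, (insert p (τ.erase v), q) ∉ H) :
    lookahead H (tops σ ((τ, p) :: g))
      = stack (lookahead H (tops σ g)) (insert p (τ.erase a)) q := by
  have hp : p ∉ τ := (hV.suffix hg).notMem
  ext G
  rw [mem_stack, mem_lookahead_iff hV hg, mem_lookahead_cons_iff]
  constructor
  · rintro (hG | ⟨v, hv, hG⟩)
    · exact Or.inl ⟨fun e => notMem_of_mem_lookahead_erase hV hg hG
        (e ▸ Finset.mem_insert_self _ _), Or.inl hG⟩
    · by_cases hva : v = a
      · subst hva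
        rw [subdiv_of_mem hV hq, Finset.mem_image] at hG
        exact Or.inr hG
      · rw [subdiv_of_notMem (h0 v hv hva), Finset.mem_singleton] at hG
        exact Or.inl ⟨fun e => hva (insert_erase_injOn hp hv (hG.symm.trans e)),
          Or.inr ⟨v, hv, hG.symm⟩⟩
  · rintro (⟨hGa, hG | ⟨v, hv, rfl⟩⟩ | hG)
    · exact Or.inl hG
    · have hva : v ≠ a := fun e => hGa (by rw [e])
      exact Or.inr ⟨v, hv, by rw [subdiv_of_notMem (h0 v hv hva), Finset.mem_singleton]⟩
    · exact Or.inr ⟨a, ha, by rwa [subdiv_of_mem hV hq, Finset.mem_image]⟩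

lemma lookahead_cons_eq_two {qa qb : α} (ha : a ∈ τ) (hb : b ∈ τ) (hab : a ≠ b)
    (hqa : (insert p (τ.erase a), qa) ∈ H) (hqb : (insert p (τ.erase b), qb) ∈ H)
    (h0 : ∀ v ∈ τ, v ≠ a → v ≠ b → ∀ q, (insert p (τ.erase v), q) ∉ H) :
    lookahead H (tops σ ((τ, p) :: g))
      = stack (stack (lookahead H (tops σ g)) (insert p (τ.erase a)) qa)
          (insert p (τ.erase b)) qb := by
  have hp : p ∉ τ := (hV.suffix hg).notMem
  have hqaV := notMem_verts_lookahead hV hg hqa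
  ext G
  rw [mem_stack, mem_stack, mem_lookahead_iff hV hg, mem_lookahead_cons_iff]
  constructor
  · rintro (hG | ⟨v, hv, hG⟩)
    · have hpG := notMem_of_mem_lookahead_erase hV hg hG
      exact Or.inl ⟨fun e => hpG (e ▸ Finset.mem_insert_self _ _),
        Or.inl ⟨fun e => hpG (e ▸ Finset.mem_insert_self _ _), Or.inl hG⟩⟩
    · by_cases hva : v = a
      · subst hva
        rw [subdiv_of_mem hV hqa, Finset.mem_image] at hG
        refine Or.inl ⟨fun e => ?_, Or.inr hG⟩
        obtain ⟨w, -, rfl⟩ := hG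
        refine notMem_of_notMem_verts hqaV ((mem_lookahead_iff hV hg).2 (Or.inr ⟨b, hb, rfl⟩)) ?_
        rw [← e]
        exact Finset.mem_insert_self _ _
      · by_cases hvb : v = b
        · subst hvb
          rw [subdiv_of_mem hV hqb, Finset.mem_image] at hG
          exact Or.inr hG
        · rw [subdiv_of_notMem (h0 v hv hva hvb), Finset.mem_singleton] at hG
          exact Or.inl ⟨fun e => hvb (insert_erase_injOn hp hv (hG.symm.trans e)),
            Or.inl ⟨fun e => hva (insert_erase_injOn hp hv (hG.symm.trans e)),
              Or.inr ⟨v, hv, hG.symm⟩⟩⟩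
  · rintro (⟨hGb, ⟨hGa, hG | ⟨v, hv, rfl⟩⟩ | hG⟩ | hG)
    · exact Or.inl hG
    · have hva : v ≠ a := fun e => hGa (by rw [e])
      have hvb : v ≠ b := fun e => hGb (by rw [e])
      exact Or.inr ⟨v, hv, by rw [subdiv_of_notMem (h0 v hv hva hvb), Finset.mem_singleton]⟩
    · exact Or.inr ⟨a, ha, by rwa [subdiv_of_mem hV hqa, Finset.mem_image]⟩
    · exact Or.inr ⟨b, hb, by rwa [subdiv_of_mem hV hqb, Finset.mem_image]⟩

end Step

end Lookahead

/-! ### Sufficiency: realization one generation ahead. -/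

section Sufficiency

variable {α E : Type*} [DecidableEq α] [NormedAddCommGroup E] [InnerProductSpace ℝ E]
  {σ : Finset α} {H : List (Finset α × α)} {f : α → E} {l : α → E →ᵃ[ℝ] ℝ} {q : α}

/-- A simplex subdivided at its centroid is Delaunay. -/
lemma IsBary.exists_isDel_stack (hl : IsBary σ f l) (hc : 2 ≤ σ.card) (hq : q ∉ σ) :
    ∃ f' : α → E, IsDel (stack {σ} σ q) f' ∧ IsCov (stack {σ} σ q) f' := by
  have hcov : IsCov {σ} f := fun y hy => ⟨σ, Finset.mem_singleton_self _, by simpa [verts] using hy⟩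
  have hqV : q ∉ verts {σ} := by simpa [verts] using hq
  have hσ : σ.Nonempty := Finset.card_pos.1 (by omega)
  have hcpos : (0 : ℝ) < σ.card := by exact_mod_cast hσ.card_pos
  set x : E := ∑ v ∈ σ, (σ.card : ℝ)⁻¹ • f v with hx
  have hlx : ∀ v ∈ σ, 0 < l v x := by
    intro v hv
    rw [hx, affineMap_sum_smul (l v) σ (fun _ => (σ.card : ℝ)⁻¹) f (by simp [hcpos.ne'])]
    rw [Finset.sum_eq_single_of_mem v hv fun w hw hwv => by rw [hl.other v hv w hw hwv.symm, mul_zero],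
      hl.self v hv, mul_one]
    exact inv_pos.2 hcpos
  refine ⟨Function.update f q x, ?_, hcov.stack (Finset.mem_singleton_self _) hc hqV hl hlx⟩
  set f' := Function.update f q x with hf'
  have hf'q : f' q = x := Function.update_self _ _ _
  have hf'v : ∀ v ∈ σ, f' v = f v := fun v hv =>
    Function.update_of_ne (fun e => hq (by rwa [← e])) _ _
  -- The affine function interpolating `-‖y‖ ^ 2` at the vertices gives the circumsphere of `σ`.
  let A : E →ᵃ[ℝ] ℝ := ∑ v ∈ σ, (-‖f v‖ ^ 2) • l v
  have hsum : ∀ (s : Finset α) (y : E), (∑ v ∈ s, (-‖f v‖ ^ 2) • l v) y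
      = ∑ v ∈ s, -‖f v‖ ^ 2 * l v y := fun s y => by
    induction s using Finset.induction_on with
    | empty => simp
    | insert v s hv ih => rw [Finset.sum_insert hv, Finset.sum_insert hv, ← ih]; rfl
  have hA : ∀ v ∈ σ, pw A (f v) = 0 := by
    intro v hv
    simp only [pw, A]
    rw [hsum, Finset.sum_eq_single_of_mem v hv fun w hw hwv => by
      rw [hl.other w hw v hv hwv, mul_zero], hl.self v hv]
    ring
  obtain ⟨a, ha, b, hb, hab⟩ := Finset.one_lt_card.1 (by omega : 1 < σ.card)
  have hneg : pw A x < 0 := hl.pw_neg hA hlx ha fun e => by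
    have := hlx b hb
    rw [← e, hl.other b hb a ha hab.symm] at this
    exact lt_irrefl _ this
  have hmem : ∀ G ∈ stack {σ} σ q, ∃ v ∈ σ, insert q (σ.erase v) = G := by
    intro G hG
    rcases mem_stack.1 hG with ⟨h1, h2⟩ | h
    · exact absurd (Finset.mem_singleton.1 h2) h1
    · exact h
  refine ⟨fun G hG => ?_, fun G hG => ?_⟩
  · obtain ⟨v, hv, rfl⟩ := hmem G hG
    have h1 : IsBary (insert v (σ.erase v)) f' l := by
      rw [Finset.insert_erase hv]
      exact hl.congr fun v hv => (hf'v v hv).symm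
    exact ⟨_, h1.exchange (Finset.notMem_erase v σ) (fun hh => hq (Finset.mem_of_mem_erase hh))
      (by rw [hf'q]; exact (hlx v hv).ne')⟩
  · obtain ⟨v, hv, rfl⟩ := hmem G hG
    have hlv := hlx v hv
    refine ⟨A + (-(pw A x) / l v x) • l v, fun k hk => ?_, fun w hw hwG => ?_⟩
    · rw [pw_add_smul]
      rcases Finset.mem_insert.1 hk with rfl | hk
      · rw [hf'q, div_mul_cancel₀ _ hlv.ne', add_neg_cancel]
      · obtain ⟨hkv, hkF⟩ := Finset.mem_erase.1 hk
        rw [hf'v k hkF, hA k hkF, hl.other v hv k hkF hkv.symm, mul_zero, add_zero]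
    · rw [verts_stack (Finset.mem_singleton_self _) hc] at hw
      have hwq : w ≠ q := fun e => hwG (e ▸ Finset.mem_insert_self _ _)
      have hw : w ∈ σ := by
        simpa [verts] using (Finset.mem_insert.1 hw).resolve_left hwq
      have hwv : w = v := by
        by_contra hne
        exact hwG (Finset.mem_insert_of_mem (Finset.mem_erase.2 ⟨hne, hw⟩))
      subst hwv
      rw [pw_add_smul, hf'v w hw, hA w hw, hl.self w hw, mul_one, zero_add]
      exact div_pos (neg_pos.2 hneg) hlv

/-- A history in which at most two simplices generated by each single stellar subdivision are
further subdivided has a Delaunay realization. -/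
theorem Valid.exists_isDel (hV : Valid σ H) (hH : H ≠ []) (hl : IsBary σ f l) (hc : 2 ≤ σ.card)
    (h2 : ∀ s ∈ H, {F | (∃ v ∈ s.1, F = insert s.2 (s.1.erase v)) ∧
      ∃ t ∈ H, t.1 = F}.encard ≤ 2) :
    ∃ f' : α → E, IsDel (tops σ H) f' ∧ IsCov (tops σ H) f' := by
  suffices key : ∀ g, g <:+ H → ∃ f' : α → E, IsDel (lookahead H (tops σ g)) f' ∧
      IsCov (lookahead H (tops σ g)) f' by
    simpa only [lookahead_tops hV] using key H (List.suffix_refl H)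
  intro g
  induction g with
  | nil =>
    intro _
    -- The oldest entry is last in the list, and it can only subdivide `σ`.
    obtain ⟨k, t, rfl⟩ := List.eq_nil_or_concat' H |>.resolve_left hH
    have ht : [t] <:+ k ++ [t] := List.suffix_append _ _
    have hVt := hV.suffix ht
    have htσ : t.1 = σ := Finset.mem_singleton.1 hVt.2.1
    have htm : (σ, t.2) ∈ k ++ [t] := by
      rw [← htσ]
      exact ht.subset List.mem_cons_self
    have heq : lookahead (k ++ [t]) (tops σ []) = stack {σ} σ t.2 := by
      rw [tops, lookahead, Finset.singleton_biUnion, subdiv_of_mem hV htm, stack]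
      simp
    rw [heq]
    exact hl.exists_isDel_stack hc hVt.2.2
  | cons s g ih =>
    obtain ⟨τ, p⟩ := s
    intro hg
    have hgH : g <:+ H := (List.suffix_cons _ _).trans hg
    obtain ⟨f, hf, hcov⟩ := ih hgH
    have hVs := hV.suffix hg
    have hp : p ∉ τ := hVs.notMem
    have hcτ : 2 ≤ τ.card := by rw [hVs.1.card_eq hVs.2.1]; exact hc
    have hcard : ∀ G ∈ lookahead H (tops σ g), G.card = σ.card := fun G hG =>
      card_of_mem_lookahead hV hgH hG
    have hS : ∀ v ∈ τ, insert p (τ.erase v) ∈ lookahead H (tops σ g) := fun v hv =>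
      (mem_lookahead_iff hV hg).2 (Or.inr ⟨v, hv, rfl⟩)
    have hpS : ∀ G ∈ lookahead H (tops σ g), p ∈ G → ∃ v ∈ τ, G = insert p (τ.erase v) := by
      intro G hG hpG
      rcases (mem_lookahead_iff hV hg).1 hG with h1 | ⟨v, hv, h1⟩
      · exact absurd hpG (notMem_of_mem_lookahead_erase hV hg h1)
      · exact ⟨v, hv, h1.symm⟩
    classical
    set P := τ.filter fun v => ∃ q, (insert p (τ.erase v), q) ∈ H with hP
    have hPc : P.card ≤ 2 := by
      have h3 := h2 (τ, p) (hg.subset List.mem_cons_self)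
      have h4 : ((P.image fun v => insert p (τ.erase v) : Finset (Finset α)) : Set (Finset α)) ⊆
          {F | (∃ v ∈ τ, F = insert p (τ.erase v)) ∧ ∃ t ∈ H, t.1 = F} := by
        intro F hF
        obtain ⟨v, hv, rfl⟩ := Finset.mem_image.1 (Finset.mem_coe.1 hF)
        obtain ⟨hv, q, hq⟩ := Finset.mem_filter.1 hv
        exact ⟨⟨v, hv, rfl⟩, _, hq, rfl⟩
      have h5 := (Set.encard_le_encard h4).trans h3
      rw [Set.encard_coe_eq_coe_finsetCard, Finset.card_image_of_injOn fun v hv w hw e =>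
        insert_erase_injOn hp (Finset.mem_filter.1 hv).1 e] at h5
      exact_mod_cast h5
    have hPmem : ∀ v ∈ P, v ∈ τ ∧ ∃ q, (insert p (τ.erase v), q) ∈ H := fun v hv =>
      Finset.mem_filter.1 hv
    have hPn : ∀ v ∈ τ, v ∉ P → ∀ q, (insert p (τ.erase v), q) ∉ H := fun v hv hvP q hq =>
      hvP (Finset.mem_filter.2 ⟨hv, q, hq⟩)
    have hcases : P.card = 0 ∨ P.card = 1 ∨ P.card = 2 := by omega
    rcases hcases with h0 | h0 | h0
    · rw [Finset.card_eq_zero] at h0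
      rw [lookahead_cons_eq_zero hV hg fun v hv => hPn v hv (by simp [h0])]
      exact ⟨f, hf, hcov⟩
    · obtain ⟨a, h0⟩ := Finset.card_eq_one.1 h0
      obtain ⟨ha, q, hq⟩ := hPmem a (by simp [h0])
      rw [lookahead_cons_eq_one hV hg ha hq fun v hv hva => hPn v hv (by simp [h0, hva])]
      exact hf.exists_stack_one hcov hcard hc hp hcτ hS hpS ha (notMem_verts_lookahead hV hg hq)
    · obtain ⟨a, b, hab, h0⟩ := Finset.card_eq_two.1 h0
      obtain ⟨ha, qa, hqa⟩ := hPmem a (by simp [h0])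
      obtain ⟨hb, qb, hqb⟩ := hPmem b (by simp [h0])
      rw [lookahead_cons_eq_two hV hg ha hb hab hqa hqb fun v hv hva hvb =>
        hPn v hv (by simp [h0, hva, hvb])]
      refine hf.exists_stack_two hcov hcard hc hp hcτ hS hpS ha hb hab
        (notMem_verts_lookahead hV hg hqa) (notMem_verts_lookahead hV hg hqb) fun e => hab ?_
      exact (insert_erase_injOn hp hb (Prod.mk.inj (hV.snd_injective hqa hqb e)).1).symm

end Sufficiency

/-! ### Simplicial complexes -/

section Complex

variable {α E : Type*} [DecidableEq α] [NormedAddCommGroup E] [InnerProductSpace ℝ E]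
  {F s : Finset α} {S : Finset (Finset α)} {f : α → E} {l : α → E →ᵃ[ℝ] ℝ} {y : E} {v : α}

omit [DecidableEq α] in
lemma exists_isBary [FiniteDimensional ℝ E] (h : AffineIndependent ℝ fun v : F => f v)
    (hc : F.card = Module.finrank ℝ E + 1) : ∃ l, IsBary F f l := by
  classical
  have htop := (h.affineSpan_eq_top_iff_card_eq_finrank_add_one).2 (by simpa using hc)
  let b : AffineBasis F ℝ E := ⟨fun v : F => f v, h, htop⟩
  have hb : ∀ v : F, b v = f v := fun v => rfl
  have hl : ∀ v (hv : v ∈ F), (if hv : v ∈ F then b.coord ⟨v, hv⟩ else 0) = b.coord ⟨v, hv⟩ :=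
    fun v hv => dif_pos hv
  refine ⟨fun v => if hv : v ∈ F then b.coord ⟨v, hv⟩ else 0, ?_, ?_, ?_, ?_⟩
  · intro v hv
    simp only [hl v hv]
    exact b.coord_apply_eq ⟨v, hv⟩
  · intro v hv w hw hvw
    simp only [hl v hv]
    exact b.coord_apply_ne (i := ⟨v, hv⟩) (j := ⟨w, hw⟩) fun e => hvw (congrArg Subtype.val e)
  · intro y
    rw [← Finset.sum_coe_sort]
    simpa using b.sum_coord_apply_eq_one y
  · intro y
    rw [← Finset.sum_coe_sort]
    simpa [hb] using b.linear_combination_coord_eq_self y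

omit [DecidableEq α] in
lemma IsBary.affineIndependent (hl : IsBary F f l) : AffineIndependent ℝ fun v : F => f v := by
  classical
  rw [affineIndependent_iff]
  intro s w hw hs e he
  have h1 : ∑ i ∈ s, w i * l e (f i) = w e := by
    rw [Finset.sum_eq_single_of_mem e he, hl.self e e.2, mul_one]
    intro i _ hie
    rw [hl.other e e.2 i i.2 fun h => hie (Subtype.ext h).symm, mul_zero]
  have h2 := congrArg (l e).linear hs
  have h3 : ∀ z, l e z = (l e).linear z + l e 0 := fun z => congrFun (l e).decomp z
  simp only [map_sum, map_smul, map_zero, smul_eq_mul] at h2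
  rw [← h1]
  simp only [h3 (f _), mul_add, Finset.sum_add_distrib, h2, ← Finset.sum_mul, hw, zero_mul,
    add_zero]

omit [DecidableEq α] in
lemma IsBary.affineIndependent_image [DecidableEq E] (hl : IsBary F f l) (hs : s ⊆ F) :
    AffineIndependent ℝ ((↑) : ↥(s.image f) → E) := by
  have hsub : ((s.image f : Finset E) : Set E) ⊆ Set.range fun v : F => f v := by
    intro x hx
    obtain ⟨v, hv, rfl⟩ := Finset.mem_image.1 (Finset.mem_coe.1 hx)
    exact ⟨⟨v, hs hv⟩, rfl⟩
  exact hl.affineIndependent.range.mono hsub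

omit [DecidableEq α] in
lemma IsBary.eq_zero_of_mem_convexHull (hl : IsBary F f l) (hs : s ⊆ F)
    (hy : y ∈ convexHull ℝ (f '' s)) (hv : v ∈ F) (hvs : v ∉ s) : l v y = 0 := by
  have h1 : Convex ℝ {y | l v y = 0} := (convex_singleton (0 : ℝ)).affine_preimage (l v)
  refine convexHull_min ?_ h1 hy
  rintro _ ⟨w, hw, rfl⟩
  exact hl.other v hv w (hs hw) fun e => hvs (e ▸ hw)

lemma IsDel.injOn (h : IsDel S f) : Set.InjOn f (verts S : Set α) := by
  intro v hv w hw hvw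
  obtain ⟨F, hF, hvF⟩ := mem_verts.1 (Finset.mem_coe.1 hv)
  obtain ⟨l, hl⟩ := h.bary F hF
  obtain ⟨A, hA⟩ := h.sphere F hF
  by_cases hwF : w ∈ F
  · exact hl.injOn hvF hwF hvw
  · have h1 := hA.2 w (Finset.mem_coe.1 hw) hwF
    rw [← hvw, hA.1 v hvF] at h1
    exact absurd h1 (lt_irrefl _)

/-- A point common to two simplices is supported on their common vertices. -/
lemma IsDel.mem_of_coord_ne_zero (h : IsDel S f) {G : Finset α} (hF : F ∈ S) (hG : G ∈ S)
    (hl : IsBary F f l) (hyF : y ∈ convexHull ℝ (f '' F)) (hyG : y ∈ convexHull ℝ (f '' G))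
    (hv : v ∈ F) (hne : l v y ≠ 0) : v ∈ G := by
  obtain ⟨A, hA⟩ := h.sphere F hF
  obtain ⟨B, hB⟩ := h.sphere G hG
  by_contra hvG
  have hnonneg : ∀ {C : E →ᵃ[ℝ] ℝ} {K : Finset α}, K ∈ S → IsEmptySphere S f K C →
      ∀ {w G}, G ∈ S → w ∈ G → 0 ≤ pw C (f w) := by
    intro C K hK hC w G hG hw
    by_cases hwK : w ∈ K
    · exact (hC.1 w hwK).ge
    · exact (hC.2 w (mem_verts.2 ⟨G, hG, hw⟩) hwK).le
  -- `A - B` is nonnegative on the simplex `G` and nonpositive on `F`, so it vanishes at the common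
  -- point `y`. A vertex of `F` outside `G` has a negative value and thus no weight in `y`.
  have h1 : 0 ≤ (A - B) y := by
    have hconv : Convex ℝ {y | 0 ≤ (A - B) y} := (convex_Ici (0 : ℝ)).affine_preimage (A - B)
    refine convexHull_min ?_ hconv hyG
    rintro _ ⟨w, hw, rfl⟩
    change 0 ≤ (A - B) (f w)
    rw [← pw_sub_pw, hB.1 w hw, sub_zero]
    exact hnonneg hF hA hG hw
  have h2 : ∀ w ∈ F, l w y * (A - B) (f w) ≤ 0 := fun w hw => by
    rw [← pw_sub_pw, hA.1 w hw, zero_sub, mul_neg]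
    exact neg_nonpos.2 (mul_nonneg (hl.nonneg_of_mem_convexHull hyF hw) (hnonneg hG hB hF hw))
  have h3 : l v y * (A - B) (f v) < 0 := by
    rw [← pw_sub_pw, hA.1 v hv, zero_sub, mul_neg]
    exact neg_neg_of_pos (mul_pos ((hl.nonneg_of_mem_convexHull hyF hv).lt_of_ne' hne)
      (hB.2 v (mem_verts.2 ⟨F, hF, hv⟩) hvG))
  rw [hl.apply_eq (A - B) y] at h1
  exact absurd (Finset.sum_lt_sum h2 ⟨v, hv, h3⟩) (by simpa using h1)

/-- The weights of `y` in `F` and in `G` live on common vertices and agree there, so they vanish off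
`s` and off `t`. -/
lemma IsDel.mem_convexHull_inter (h : IsDel S f) {G t : Finset α} (hF : F ∈ S) (hG : G ∈ S)
    (hs : s ⊆ F) (ht : t ⊆ G) (hys : y ∈ convexHull ℝ (f '' s))
    (hyt : y ∈ convexHull ℝ (f '' t)) : y ∈ convexHull ℝ (f '' (s ∩ t : Finset α)) := by
  obtain ⟨l, hl⟩ := h.bary F hF
  obtain ⟨m, hm⟩ := h.bary G hG
  have hyF := convexHull_mono (Set.image_mono (Finset.coe_subset.2 hs)) hys
  have hyG := convexHull_mono (Set.image_mono (Finset.coe_subset.2 ht)) hyt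
  have heq : ∀ v ∈ F, v ∈ G → l v y = m v y := by
    intro v hv hvG
    rw [hm.apply_eq (l v) y, Finset.sum_eq_single_of_mem v hvG, hl.self v hv, mul_one]
    intro w hw hwv
    by_cases hw0 : m w y = 0
    · rw [hw0, zero_mul]
    · rw [hl.other v hv w (h.mem_of_coord_ne_zero hG hF hm hyG hyF hw hw0) hwv.symm, mul_zero]
  have hzero : ∀ v ∈ F, v ∉ s ∩ t → l v y = 0 := by
    intro v hv hvst
    by_contra hne
    have hvG := h.mem_of_coord_ne_zero hF hG hl hyF hyG hv hne
    refine hvst (Finset.mem_inter.2 ⟨?_, ?_⟩)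
    · by_contra hvs
      exact hne (hl.eq_zero_of_mem_convexHull hs hys hv hvs)
    · by_contra hvt
      exact hne ((heq v hv hvG).trans (hm.eq_zero_of_mem_convexHull ht hyt hvG hvt))
  have hsub : s ∩ t ⊆ F := Finset.inter_subset_left.trans hs
  have h1 : ∑ v ∈ s ∩ t, l v y = 1 := by
    rw [← hl.sum_eq y]
    exact Finset.sum_subset hsub hzero
  have h2 : ∑ v ∈ s ∩ t, l v y • f v = y := by
    conv_rhs => rw [← hl.sum_smul y]
    exact Finset.sum_subset hsub fun v hv hvs => by rw [hzero v hv hvs, zero_smul]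
  rw [← h2]
  exact sum_smul_mem_convexHull (fun v hv => hl.nonneg_of_mem_convexHull hyF (hsub hv)) h1

/-- The simplicial complex generated by simplices with empty circumspheres. -/
def IsDel.complex [DecidableEq E] (h : IsDel S f) : SimplicialComplex ℝ E where
  faces := (fun s : Finset α => s.image f) '' {s | s.Nonempty ∧ ∃ F ∈ S, s ⊆ F}
  isRelLowerSet_faces := by
    rintro _ ⟨s, ⟨hs, F, hF, hsF⟩, rfl⟩
    refine ⟨hs.image f, fun t ht htn => ?_⟩
    obtain ⟨u, hu, rfl⟩ := Finset.subset_image_iff.1 ht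
    exact ⟨u, ⟨Finset.image_nonempty.1 htn, F, hF, Set.Subset.trans hu hsF⟩, rfl⟩
  indep := by
    rintro _ ⟨s, ⟨hs, F, hF, hsF⟩, rfl⟩
    obtain ⟨l, hl⟩ := h.bary F hF
    exact hl.affineIndependent_image hsF
  inter_subset_convexHull := by
    rintro _ _ ⟨s, ⟨hs, F, hF, hsF⟩, rfl⟩ ⟨t, ⟨ht, G, hG, htG⟩, rfl⟩ y ⟨hys, hyt⟩
    simp only [Finset.coe_image] at hys hyt ⊢
    refine convexHull_mono ?_ (h.mem_convexHull_inter hF hG hsF htG hys hyt)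
    rw [Finset.coe_inter]
    exact Set.image_inter_subset f _ _

lemma IsDel.vertices_complex [DecidableEq E] (h : IsDel S f) :
    h.complex.vertices = ((verts S).image f : Finset E) := by
  ext x
  rw [SimplicialComplex.vertices_eq, Set.mem_iUnion₂, Finset.coe_image]
  constructor
  · rintro ⟨_, ⟨s, ⟨-, F, hF, hsF⟩, rfl⟩, hx⟩
    obtain ⟨v, hv, rfl⟩ := Finset.mem_image.1 (Finset.mem_coe.1 hx)
    exact ⟨v, mem_verts.2 ⟨F, hF, hsF hv⟩, rfl⟩
  · rintro ⟨v, hv, rfl⟩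
    obtain ⟨F, hF, hvF⟩ := mem_verts.1 (Finset.mem_coe.1 hv)
    exact ⟨F.image f, ⟨F, ⟨⟨v, hvF⟩, F, hF, subset_rfl⟩, rfl⟩, Finset.mem_image_of_mem f hvF⟩

lemma IsDel.space_complex [DecidableEq E] (h : IsDel S f) (hcov : IsCov S f) :
    h.complex.space = convexHull ℝ (((verts S).image f : Finset E) : Set E) := by
  ext y
  rw [SimplicialComplex.mem_space_iff, Finset.coe_image]
  constructor
  · rintro ⟨_, ⟨s, ⟨-, F, hF, hsF⟩, rfl⟩, hy⟩
    rw [Finset.coe_image] at hy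
    exact convexHull_mono (Set.image_mono fun v hv => mem_verts.2 ⟨F, hF, hsF hv⟩) hy
  · intro hy
    obtain ⟨F, hF, hyF⟩ := hcov y hy
    refine ⟨F.image f, ⟨F, ⟨?_, F, hF, subset_rfl⟩, rfl⟩, by rwa [Finset.coe_image]⟩
    by_contra hne
    rw [Finset.not_nonempty_iff_eq_empty] at hne
    simp [hne] at hyF

/-- The power function of a sphere. -/
lemma exists_pw_eq (c : E) (r : ℝ) : ∃ A : E →ᵃ[ℝ] ℝ, ∀ y, pw A y = dist y c ^ 2 - r ^ 2 := by
  refine ⟨((-2 : ℝ) • (innerSL ℝ c).toLinearMap).toAffineMap + AffineMap.const ℝ E (‖c‖ ^ 2 - r ^ 2),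
    fun y => ?_⟩
  rw [dist_eq_norm, norm_sub_sq_real, real_inner_comm]
  simp [pw]
  ring

/-- An affine function defines a power function with a center. -/
lemma exists_center [FiniteDimensional ℝ E] (A : E →ᵃ[ℝ] ℝ) :
    ∃ (c : E) (k : ℝ), ∀ y, pw A y = dist y c ^ 2 - k := by
  have : CompleteSpace E := FiniteDimensional.complete ℝ E
  set a := (InnerProductSpace.toDual ℝ E).symm (LinearMap.toContinuousLinearMap A.linear) with ha
  have h1 : ∀ y, inner ℝ a y = A.linear y := fun y => by
    rw [ha, InnerProductSpace.toDual_symm_apply]; rfl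
  -- Completing the square: the center is minus half the gradient of `A`.
  refine ⟨-(1 / 2 : ℝ) • a, ‖-(1 / 2 : ℝ) • a‖ ^ 2 - A 0, fun y => ?_⟩
  have h2 : A y = A.linear y + A 0 := congrFun A.decomp y
  rw [dist_eq_norm, norm_sub_sq_real, pw, h2, ← h1, inner_smul_right, real_inner_comm]
  ring

end Complex

/-! ### Passage between labelled simplices and simplicial complexes. -/

section Euclidean

variable {n : ℕ}

lemma IsDel.isDelaunayTriangulation {α : Type*} [DecidableEq α] {S : Finset (Finset α)} 
    {f : α → EuclideanSpace ℝ (Fin n)} (h : IsDel S f) (hcov : IsCov S f) (hcard : ∀ F ∈ S, F.card = n + 1) (hS : S.Nonempty) :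
    IsDelaunayTriangulation ((verts S).image f) h.complex := by
  refine ⟨?_, h.vertices_complex, h.space_complex hcov, ?_⟩
  · obtain ⟨F, hF⟩ := hS
    obtain ⟨l, hl⟩ := h.bary F hF
    have htop := (hl.affineIndependent.affineSpan_eq_top_iff_card_eq_finrank_add_one).2
      (by simpa using hcard F hF)
    rw [← top_le_iff, ← htop]
    refine affineSpan_mono ℝ ?_
    rintro _ ⟨v, rfl⟩
    exact Finset.mem_image_of_mem f (mem_verts.2 ⟨F, hF, v.2⟩)
  · rintro _ ⟨s, ⟨hs, F, hF, hsF⟩, rfl⟩ hc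
    obtain rfl : s = F := Finset.eq_of_subset_of_card_le hsF
      (by rw [hcard F hF, ← hc]; exact Finset.card_image_le)
    obtain ⟨A, hA⟩ := h.sphere s hF
    obtain ⟨c, k, hck⟩ := exists_center A
    obtain ⟨v, hv⟩ := hs
    have hk : ∀ w ∈ s, dist (f w) c ^ 2 = k := fun w hw => by
      have := hck (f w)
      rw [hA.1 w hw] at this
      linarith
    refine ⟨⟨c, dist (f v) c⟩, ?_, ?_⟩
    · intro x hx
      obtain ⟨w, hw, rfl⟩ := Finset.mem_image.1 hx
      refine (sq_eq_sq₀ dist_nonneg dist_nonneg).1 ?_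
      change dist (f w) c ^ 2 = dist (f v) c ^ 2
      rw [hk w hw, hk v hv]
    · intro x hx hxs
      rw [h.vertices_complex] at hx
      obtain ⟨w, hw, rfl⟩ := Finset.mem_image.1 (Finset.mem_coe.1 hx)
      have h1 := hA.2 w hw fun hws => hxs (Finset.mem_image_of_mem f hws)
      rw [hck] at h1
      refine (sq_lt_sq₀ dist_nonneg dist_nonneg).1 ?_
      change dist (f v) c ^ 2 < dist (f w) c ^ 2
      rw [hk v hv]
      linarith

/-- Moving from a vertex `p` directly away from another vertex `w` makes the coordinate at `w`
negative, so one leaves the simplex at once. -/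
lemma IsBary.notMem_interior {F : Finset (EuclideanSpace ℝ (Fin n))} {p : EuclideanSpace ℝ (Fin n)}
    {l : EuclideanSpace ℝ (Fin n) → EuclideanSpace ℝ (Fin n) →ᵃ[ℝ] ℝ} (hl : IsBary F id l)
    (hc : 2 ≤ F.card) (hp : p ∈ interior (convexHull ℝ (F : Set (EuclideanSpace ℝ (Fin n))))) :
    p ∉ F := by
  intro hpF
  obtain ⟨w, hw, hwp⟩ := exists_ne_mem hc p
  have h1 : Tendsto (fun t : ℝ => AffineMap.lineMap p w t) (𝓝 0) (𝓝 p) := by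
    have := (AffineMap.lineMap_continuous (R := ℝ) (p := p) (q := w)).tendsto 0
    rwa [AffineMap.lineMap_apply_zero] at this
  have h2 := h1.eventually (mem_interior_iff_mem_nhds.1 hp)
  obtain ⟨t, ht, ht0⟩ := ((h2.filter_mono nhdsWithin_le_nhds).and
    (self_mem_nhdsWithin (s := Set.Iio (0 : ℝ)))).exists
  have h3 := hl.nonneg_of_mem_convexHull (y := AffineMap.lineMap p w t) (by rw [Set.image_id]; exact ht) hw
  have h4 : l w p = 0 := hl.other w hw p hpF hwp
  have h5 : l w w = 1 := hl.self w hw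
  rw [AffineMap.apply_lineMap, h4, h5] at h3
  simp [AffineMap.lineMap_apply] at h3
  exact absurd ht0 (not_lt.2 h3)

lemma exists_isBary_of_mem_faces {K : SimplicialComplex ℝ (EuclideanSpace ℝ (Fin n))}
    {F : Finset (EuclideanSpace ℝ (Fin n))} (hF : F ∈ K.faces) (hc : F.card = n + 1) :
    ∃ l, IsBary F id l :=
  exists_isBary (K.indep hF) (by simpa using hc)

lemma vertices_eq_verts {K : SimplicialComplex ℝ (EuclideanSpace ℝ (Fin n))}
    {S : Finset (Finset (EuclideanSpace ℝ (Fin n)))}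
    (hK : K.faces = {s | s.Nonempty ∧ ∃ F ∈ S, s ⊆ F}) : K.vertices = verts S := by
  ext x
  rw [SimplicialComplex.mem_vertices, hK, Finset.mem_coe, mem_verts]
  simp

lemma StellarHistory.valid {σ : Finset (EuclideanSpace ℝ (Fin n))}
    {h : List (Finset (EuclideanSpace ℝ (Fin n)) × EuclideanSpace ℝ (Fin n))}
    {K : SimplicialComplex ℝ (EuclideanSpace ℝ (Fin n))} (hn : 1 ≤ n)
    (hK : StellarHistory σ h K) : σ.card = n + 1 ∧ (∃ l, IsBary σ id l) ∧ Valid σ h ∧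
      K.faces = {s | s.Nonempty ∧ ∃ F ∈ tops σ h, s ⊆ F} := by
  induction hK with
  | @start K hK =>
    refine ⟨hK.1, ?_, trivial, ?_⟩
    · refine exists_isBary_of_mem_faces (K := K) ?_ hK.1
      rw [hK.2]
      exact ⟨Finset.card_pos.1 (by rw [hK.1]; omega), subset_rfl⟩
    · rw [hK.2]
      simp [tops]
  | @step h K K' τ p hK hs ih =>
    obtain ⟨hc, hb, hV, hf⟩ := ih
    obtain ⟨hτK, hτc, hp, hf'⟩ := hs
    have hτ : τ ∈ tops σ h := by
      rw [hf] at hτK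
      obtain ⟨-, F, hF, hτF⟩ := hτK
      rwa [Finset.eq_of_subset_of_card_le hτF (by rw [hV.card_eq hF, hc, hτc])]
    -- A vertex of the complex lying in `τ` is a vertex of `τ`, but those are not interior points.
    have hpv : p ∉ vset σ h := by
      obtain ⟨l, hl⟩ := exists_isBary_of_mem_faces hτK hτc
      rw [← hV.verts_tops (by omega)]
      intro hpv
      rw [← Finset.mem_coe, ← vertices_eq_verts hf] at hpv
      exact hl.notMem_interior (by omega) hp
        ((SimplicialComplex.vertex_mem_convexHull_iff hpv hτK).1 (interior_subset hp))
    refine ⟨hc, hb, ⟨hV, hτ, hpv⟩, ?_⟩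
    have hpτ : p ∉ τ := fun hh => hpv (hV.tops_subset hτ hh)
    ext s
    rw [hf', hf]
    simp only [tops, Set.mem_union, Set.mem_sdiff, Set.mem_singleton_iff, Set.mem_ofPred_eq,
      mem_stack]
    constructor
    · rintro (⟨⟨hs, F, hF, hsF⟩, hsτ⟩ | ⟨τ', hτ', rfl⟩)
      · refine ⟨hs, ?_⟩
        by_cases hFτ : F = τ
        · subst hFτ
          obtain ⟨v, hv, hvs⟩ := Finset.exists_of_ssubset (hsF.ssubset_of_ne hsτ)
          exact ⟨_, Or.inr ⟨v, hv, rfl⟩, (Finset.subset_erase.2 ⟨hsF, hvs⟩).trans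
            (Finset.subset_insert _ _)⟩
        · exact ⟨F, Or.inl ⟨hFτ, hF⟩, hsF⟩
      · obtain ⟨v, hv, hvs⟩ := Finset.exists_of_ssubset hτ'
        exact ⟨Finset.insert_nonempty _ _, _, Or.inr ⟨v, hv, rfl⟩,
          Finset.insert_subset_insert _ (Finset.subset_erase.2 ⟨hτ'.1, hvs⟩)⟩
    · rintro ⟨hs, F, ⟨hFτ, hF⟩ | ⟨v, hv, rfl⟩, hsF⟩
      · refine Or.inl ⟨⟨hs, F, hF, hsF⟩, ?_⟩
        rintro rfl
        exact hFτ (Finset.eq_of_subset_of_card_le hsF (by rw [hV.card_eq hF, hV.card_eq hτ])).symm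
      · by_cases hps : p ∈ s
        · refine Or.inr ⟨s.erase p, ?_, (Finset.insert_erase hps).symm⟩
          refine Finset.ssubset_of_subset_of_ssubset ?_ (Finset.erase_ssubset hv)
          exact Finset.subset_insert_iff.1 hsF
        · have hsv : s ⊆ τ.erase v := (Finset.subset_insert_iff_of_notMem hps).1 hsF
          refine Or.inl ⟨⟨hs, τ, hτ, hsv.trans (Finset.erase_subset _ _)⟩, ?_⟩
          rintro rfl
          exact Finset.notMem_erase v s (hsv hv)

/-- Only the full-dimensional faces of `D` matter: their independence supplies barycentric
coordinates and their supporting spheres the power functions, both pulled back along `f`. -/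
lemma IsDel.of_isDelaunayTriangulation {W : Finset (EuclideanSpace ℝ (Fin n))}
    {T D : SimplicialComplex ℝ (EuclideanSpace ℝ (Fin n))}
    {S : Finset (Finset (EuclideanSpace ℝ (Fin n)))}
    {f : EuclideanSpace ℝ (Fin n) → EuclideanSpace ℝ (Fin n)}
    (hT : T.faces = {s | s.Nonempty ∧ ∃ F ∈ S, s ⊆ F}) (hcard : ∀ F ∈ S, F.card = n + 1)
    (hD : IsDelaunayTriangulation W D) (hf : Set.InjOn f T.vertices)
    (hTD : D.faces = (fun s : Finset _ => s.image f) '' T.faces) : IsDel S f := by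
  rw [vertices_eq_verts hT] at hf
  have hsub : ∀ F ∈ S, (F : Set (EuclideanSpace ℝ (Fin n))) ⊆ verts S := fun F hF v hv =>
    mem_verts.2 ⟨F, hF, hv⟩
  have hmem : ∀ F ∈ S, F.image f ∈ D.faces := fun F hF => by
    rw [hTD, hT]
    exact ⟨F, ⟨Finset.card_pos.1 (by rw [hcard F hF]; omega), F, hF, subset_rfl⟩, rfl⟩
  refine ⟨fun F hF => ?_, fun F hF => ?_⟩
  · refine exists_isBary ?_ (by simpa using hcard F hF)
    have hinj := hf.mono (hsub F hF)
    let e : F ↪ ↥(F.image f) := ⟨fun v => ⟨f v, Finset.mem_image_of_mem f v.2⟩, fun v w hvw =>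
      Subtype.ext (hinj v.2 w.2 (congrArg Subtype.val hvw))⟩
    have hi := (D.indep (hmem F hF)).comp_embedding e
    exact hi
  · obtain ⟨C, hC, hC'⟩ := hD.2.2.2 _ (hmem F hF)
      (by rw [Finset.card_image_of_injOn (hf.mono (hsub F hF)), hcard F hF])
    obtain ⟨A, hA⟩ := exists_pw_eq C.center C.radius
    refine ⟨A, fun v hv => ?_, fun w hw hwF => ?_⟩
    · rw [hA, hC _ (Finset.mem_image_of_mem f hv), sub_self]
    -- A `Sphere` may have negative radius; a vertex at that distance rules this out, so that
    -- distances may be squared.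
    · have hr : 0 ≤ C.radius := by
        obtain ⟨v, hv⟩ := Finset.card_pos.1 (show 0 < F.card by rw [hcard F hF]; omega)
        exact dist_nonneg.trans_eq (hC _ (Finset.mem_image_of_mem f hv))
      rw [hA, sub_pos]
      refine pow_lt_pow_left₀ (hC' (f w) ?_ ?_) hr two_ne_zero
      · rw [SimplicialComplex.mem_vertices, hTD, hT]
        obtain ⟨G, hG, hwG⟩ := mem_verts.1 hw
        exact ⟨{w}, ⟨Finset.singleton_nonempty w, G, hG, Finset.singleton_subset_iff.2 hwG⟩,
          Finset.image_singleton f w⟩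
      · intro hh
        obtain ⟨v, hv, hvw⟩ := Finset.mem_image.1 hh
        exact hwF (hf (hsub F hF hv) (Finset.mem_coe.2 hw) hvw ▸ hv)

end Euclidean

end StellarDelaunay

open StellarDelaunay in
/-- Here `n = d - 1` is the dimension of the subdivided simplex. -/
theorem theorem2 (n : ℕ) (hn : 1 ≤ n)
    (σ : Finset (EuclideanSpace ℝ (Fin n)))
    (h : List (Finset (EuclideanSpace ℝ (Fin n)) × EuclideanSpace ℝ (Fin n)))
    (T : Geometry.SimplicialComplex ℝ (EuclideanSpace ℝ (Fin n)))
    (hT : IsMultipleStellarSubdivision σ h T) :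
    RealizableAsDelaunay T ↔ ∀ s ∈ h, (furtherSubdivided h s).encard ≤ 2 := by
  obtain ⟨hne, hT⟩ := hT
  obtain ⟨hc, ⟨l, hl⟩, hV, hf⟩ := hT.valid hn
  have hcard : ∀ F ∈ tops σ h, F.card = n + 1 := fun F hF => (hV.card_eq hF).trans hc
  constructor
  · rintro ⟨W, D, hD, f, hfinj, hTD⟩ s hs
    exact (IsDel.of_isDelaunayTriangulation hf hcard hD hfinj hTD).encard_le_two hV (by omega) hs
  · intro h2
    obtain ⟨f, hdel, hcov⟩ := hV.exists_isDel hne hl (by omega) h2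
    have hS : (tops σ h).Nonempty := by
      obtain ⟨v, hv⟩ := Finset.card_pos.1 (show 0 < σ.card by omega)
      have : v ∈ verts (tops σ h) := by
        rw [hV.verts_tops (by omega)]
        exact vset_mono (List.nil_suffix) hv
      obtain ⟨F, hF, -⟩ := mem_verts.1 this
      exact ⟨F, hF⟩
    refine ⟨_, hdel.complex, hdel.isDelaunayTriangulation hcov hcard hS, f, ?_, ?_⟩
    · rw [vertices_eq_verts hf]
      exact hdel.injOn
    · rw [hf]
      rfl
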